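/- Let $p,q$ be positive integers and let $(\bar M,J,g)$ be a locally metallic Riemannian manifold of dimension $n+r$: $g$ is a Riemannian metric, $J$ is a $(1,1)$-tensor field with $J^2=pJ+qI$ and $g(JX,Y)=g(X,JY)$, and $\bar\nabla J=0$ for the Levi-Civita connection $\bar\nabla$ of $g$. Let $M$ be an $n$-dimensional isometrically immersed submanifold of $\bar M$, with induced metric also denoted by $g$ and Levi-Civita connection $\nabla$. Let $N_1,\dots,N_r$ be a smooth orthonormal frame of the normal bundle $TM^\perp$ (over an open subset $U\subseteq M$; all statements below are over $U$). Write $W=W^T+W^\perp$ for the decomposition of a vector of $T_x\bar M$, $x\in M$, into its tangential and normal parts, and for vector fields $X,Y$ on $M$ put - $h_\alpha(X,Y)=g((\bar\nabla_XY)^\perp,N_\alpha)$, the second fundamental forms; - $A_{N_\alpha}$, the shape operators, given by $g(A_{N_\alpha}X,Y)=h_\alpha(X,Y)$; - $\lambda_{\alpha\beta}(X)=g((\bar\nabla_XN_\alpha)^\perp,N_\beta)$, the normal connection forms, so that $\nabla^\perp_XN_\alpha=\sum_{\beta}\lambda_{\alpha\beta}(X)N_\beta$. Let $\Sigma=(T,g,\eta_\alpha,\xi_\alpha,(a_{\alpha\beta}))_{1\le\alpha,\beta\le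 r}$ be the induced structure on $M$, defined by $$JX=TX+\sum_{\alpha=1}^r\eta_\alpha(X)N_\alpha,\qquad JN_\alpha=\xi_\alpha+\sum_{\beta=1}^ra_{\alpha\beta}N_\beta,$$ where $TX=(JX)^T$ and $\xi_\alpha=(JN_\alpha)^T$ are tangent to $M$. For smooth $X,Y$, the vector fields $TY$, $\xi_\alpha$ and the functions $\eta_\alpha(Y)$, $a_{\alpha\beta}$ are differentiable, and for all smooth vector fields $X,Y$ tangent to $M$ and all $1\le\alpha,\beta\le r$: 1. $(\nabla_XT)Y=\sum_{\alpha=1}^r\left[\eta_\alpha(Y)A_{N_\alpha}X+h_\alpha(X,Y)\xi_\alpha\right]$; 2. $(\nabla_X\eta_\alpha)Y=-h_\alpha(X,TY)+\sum_{\beta=1}^r\left[a_{\alpha\beta}h_\beta(X,Y)+\eta_\beta(Y)\lambda_{\alpha\beta}(X)\right]$; 3. $\nabla_X\xi_\alpha=-T(A_{N_\alpha}X)+\sum_{\beta=1}^r\left[a_{\alpha\beta}A_{N_\beta}X+\lambda_{\alpha\beta}(X)\xi_\beta\right]$; 4. $X(a_{\alpha\beta})=-\left[h_\alpha(X,\xi_\beta)+h_\beta(X,\xi_\alpha)\right]-\sum_{\gamma=1}^r\left[a_{\alpha\gamma}\lambda_{\gamma\beta}(X)+a_{\beta\gamma}\lambda_{\gamma\alpha}(X)\right]$.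 Here $(\nabla_XT)Y=\nabla_X(TY)-T(\nabla_XY)$ and $(\nabla_X\eta_\alpha)Y=X(\eta_\alpha(Y))-\eta_\alpha(\nabla_XY)$. -/

import Mathlib

open Bundle Manifold
open scoped ContDiff

noncomputable section

namespace MetallicSubmanifold

section Ambient

variable {m : ℕ} {M : Type*} [TopologicalSpace M] [ChartedSpace (EuclideanSpace ℝ (Fin m)) M]
  [IsManifold (𝓡 m) ∞ M]

variable (m M) in
/-- Linear connections on the tangent bundle of `M`; `D Y x u` is `(∇_u Y)(x)`. -/
abbrev LinearConnection :=
  CovariantDerivative (𝓡 m) (EuclideanSpace ℝ (Fin m)) (TangentSpace (𝓡 m) : M → Type _)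

/-- `(∇_u S) Y = ∇_u (S Y) - S (∇_u Y)` at the point `x`, for a field `S` of endomorphisms of the
tangent spaces. -/
def covDerivEndo (D : LinearConnection m M)
    (S : Π x : M, TangentSpace (𝓡 m) x → TangentSpace (𝓡 m) x)
    (Y : Π x : M, TangentSpace (𝓡 m) x) (x : M) (u : TangentSpace (𝓡 m) x) :
    TangentSpace (𝓡 m) x :=
  D (fun y ↦ S y (Y y)) x u - S x (D Y x u)

/-- `(∇_u θ) Y = u (θ Y) - θ (∇_u Y)` at the point `x`, for a one-form `θ`. -/
def covDerivForm (D : LinearConnection m M)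
    (θ : Π x : M, TangentSpace (𝓡 m) x → ℝ)
    (Y : Π x : M, TangentSpace (𝓡 m) x) (x : M) (u : TangentSpace (𝓡 m) x) : ℝ :=
  mvfderiv (𝓡 m) (fun y ↦ θ y (Y y)) x u - θ x (D Y x u)

variable [RiemannianBundle (fun x : M ↦ TangentSpace (𝓡 m) x)]

/-- `(J, g)` is a metallic Riemannian structure: `J` is a smooth `(1,1)`-tensor field with
`J² = p J + q I`, where `p` and `q` are positive integers, and `g(Ju, v) = g(u, Jv)`. -/
structure IsMetallicRiemannian (p q : ℕ)
    (J : Π x : M, TangentSpace (𝓡 m) x →L[ℝ] TangentSpace (𝓡 m) x) : Prop where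
  p_pos : 0 < p
  q_pos : 0 < q
  smooth : ContMDiff (𝓡 m)
    ((𝓡 m).prod 𝓘(ℝ, EuclideanSpace ℝ (Fin m) →L[ℝ] EuclideanSpace ℝ (Fin m))) ∞
    (fun x ↦ TotalSpace.mk' (EuclideanSpace ℝ (Fin m) →L[ℝ] EuclideanSpace ℝ (Fin m))
      (E := fun x : M ↦ TangentSpace (𝓡 m) x →L[ℝ] TangentSpace (𝓡 m) x) x (J x))
  sq : ∀ (x : M) (u : TangentSpace (𝓡 m) x), J x (J x u) = (p : ℝ) • J x u + (q : ℝ) • u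
  symm : ∀ (x : M) (u v : TangentSpace (𝓡 m) x), inner ℝ (J x u) v = inner ℝ u (J x v)

variable [IsContMDiffRiemannianBundle (𝓡 m) ∞ (EuclideanSpace ℝ (Fin m))
  (fun x : M ↦ TangentSpace (𝓡 m) x)]

instance : IsContMDiffRiemannianBundle (𝓡 m) 1 (EuclideanSpace ℝ (Fin m))
    (fun x : M ↦ TangentSpace (𝓡 m) x) :=
  IsContMDiffRiemannianBundle.of_le (n := ∞) (by simp)

/-- `D` is the Levi-Civita connection: it is torsion-free and compatible with the metric. -/
structure IsLeviCivita (D : LinearConnection m M) : Prop where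
  torsion_eq_zero : D.torsion = 0
  metric : D.IsMetricCompatible

/-- `(M, J, g)` is a locally metallic Riemannian manifold: `(J, g)` is a metallic Riemannian
structure and `J` is parallel for the Levi-Civita connection `D`. -/
structure IsLocallyMetallic (p q : ℕ)
    (J : Π x : M, TangentSpace (𝓡 m) x →L[ℝ] TangentSpace (𝓡 m) x)
    (D : LinearConnection m M) : Prop where
  metallic : IsMetallicRiemannian p q J
  leviCivita : IsLeviCivita D
  parallel : ∀ (Y : Π x : M, TangentSpace (𝓡 m) x) (x : M) (u : TangentSpace (𝓡 m) x),
    MDifferentiableAt (𝓡 m) (𝓡 m).tangent (fun y ↦ (⟨y, Y y⟩ : TangentBundle (𝓡 m) M)) x →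
    covDerivEndo D (fun y ↦ J y) Y x u = 0

end Ambient

section Submanifold

variable {n k : ℕ} {M : Type*} [TopologicalSpace M] [ChartedSpace (EuclideanSpace ℝ (Fin n)) M]
  {P : Type*} [TopologicalSpace P] [ChartedSpace (EuclideanSpace ℝ (Fin k)) P]

variable [RiemannianBundle (fun x : M ↦ TangentSpace (𝓡 n) x)]
  [RiemannianBundle (fun x : P ↦ TangentSpace (𝓡 k) x)]

variable (n k) in
/-- `f` is a (smooth) isometric immersion: `g(u, v) = ḡ(df u, df v)`. -/
structure IsIsometricImmersion (f : M → P) : Prop where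
  smooth : ContMDiff (𝓡 n) (𝓡 k) ∞ f
  isometric : ∀ (x : M) (u v : TangentSpace (𝓡 n) x),
    inner ℝ (mfderiv (𝓡 n) (𝓡 k) f x u) (mfderiv (𝓡 n) (𝓡 k) f x v) = inner ℝ u v

/-- The differential of `f` as a linear map. -/
def dmap (f : M → P) (x : M) : TangentSpace (𝓡 n) x →ₗ[ℝ] TangentSpace (𝓡 k) (f x) :=
  (mfderiv (𝓡 n) (𝓡 k) f x : TangentSpace (𝓡 n) x →ₗ[ℝ] TangentSpace (𝓡 k) (f x))

instance (x : M) : FiniteDimensional ℝ (TangentSpace (𝓡 n) x) :=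
  inferInstanceAs (FiniteDimensional ℝ (EuclideanSpace ℝ (Fin n)))

/-- The tangential part `Wᵀ ∈ T_x M` of `W ∈ T_{f x} P`. -/
def tangentialPart (f : M → P) (x : M) :
    TangentSpace (𝓡 k) (f x) →ₗ[ℝ] TangentSpace (𝓡 n) x :=
  LinearMap.adjoint (dmap f x)

/-- The normal part `W^⊥` of `W ∈ T_{f x} P`. -/
def normalPart (f : M → P) (x : M) (W : TangentSpace (𝓡 k) (f x)) : TangentSpace (𝓡 k) (f x) :=
  W - dmap (n := n) f x (tangentialPart f x W)

/-- `W = df(Wᵀ) + W^⊥` is the orthogonal decomposition of `T_{f x} P`. -/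
theorem inner_normalPart {f : M → P} (hf : IsIsometricImmersion n k f) (x : M)
    (W : TangentSpace (𝓡 k) (f x)) (v : TangentSpace (𝓡 n) x) :
    inner ℝ (normalPart (n := n) f x W) (dmap f x v) = 0 := by
  have h := hf.isometric x (tangentialPart f x W) v
  rw [normalPart, inner_sub_left, tangentialPart, sub_eq_zero, ← LinearMap.adjoint_inner_left]
  exact h.symm

end Submanifold

section Along

variable {n k : ℕ} {M : Type*} [TopologicalSpace M] [ChartedSpace (EuclideanSpace ℝ (Fin n)) M]
  {P : Type*} [TopologicalSpace P] [ChartedSpace (EuclideanSpace ℝ (Fin k)) P]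
  [IsManifold (𝓡 k) ∞ P]

/-- The derivative `∇̄_u V` at `x` of a vector field `V` along `f : M → P`, i.e. the pullback by
`f` of the connection `D` on `P`.

In the trivialization of `TP` around `f x` let `V̂` be the coordinate vector of `V` and let `E` be
the field on `P` with constant coordinates and `E (f x) = V x`.  Then
`∇̄_u V = dV̂(u) + D_{df u} E`. -/
def covAlong (D : LinearConnection k P) (f : M → P) (V : Π x : M, TangentSpace (𝓡 k) (f x))
    (x : M) : TangentSpace (𝓡 n) x →L[ℝ] TangentSpace (𝓡 k) (f x) :=
  let e := trivializationAt (EuclideanSpace ℝ (Fin k)) (TangentSpace (𝓡 k) : P → Type _) (f x)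
  (e.symmL ℝ (f x)).comp (mvfderiv (𝓡 n)
      (fun y ↦ (e (⟨f y, V y⟩ : TangentBundle (𝓡 k) P)).2) x) +
    (D (FiberBundle.extend (EuclideanSpace ℝ (Fin k)) (V x)) (f x)).comp
      (mfderiv (𝓡 n) (𝓡 k) f x)

/-- The flat connection of a trivialization. -/
theorem isCovariantDerivativeOn_flat
    (e : Trivialization (EuclideanSpace ℝ (Fin k))
      (TotalSpace.proj : TangentBundle (𝓡 k) P → P)) [MemTrivializationAtlas e] :
    IsCovariantDerivativeOn (I := 𝓡 k) (EuclideanSpace ℝ (Fin k))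
      (V := (TangentSpace (𝓡 k) : P → Type _))
      (fun W z ↦ (e.symmL ℝ z).comp
        (mvfderiv (𝓡 k) (fun y ↦ (e (⟨y, W y⟩ : TangentBundle (𝓡 k) P)).2) z)) e.baseSet := by
  have hdiff : ∀ (p : P) (W : Π z : P, TangentSpace (𝓡 k) z), p ∈ e.baseSet →
      MDifferentiableAt (𝓡 k) (𝓡 k).tangent
      (fun z ↦ (⟨z, W z⟩ : TangentBundle (𝓡 k) P)) p →
      MDifferentiableAt (𝓡 k) 𝓘(ℝ, EuclideanSpace ℝ (Fin k))
        (fun y ↦ (e (⟨y, W y⟩ : TangentBundle (𝓡 k) P)).2) p :=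
    fun p W hp hW ↦ (e.mdifferentiableAt_section_iff (𝓡 k) W hp).1 hW
  constructor
  · intro W W' x hW hW' hp
    have hnear := e.open_baseSet.mem_nhds hp
    rw [← ContinuousLinearMap.comp_add, ← mvfderiv_add (hdiff x W hp hW) (hdiff x W' hp hW')]
    congr 1
    have : (fun y ↦ (e (⟨y, (W + W') y⟩ : TangentBundle (𝓡 k) P)).2) =ᶠ[nhds x]
        (fun y ↦ (e (⟨y, W y⟩ : TangentBundle (𝓡 k) P)).2) +
          (fun y ↦ (e (⟨y, W' y⟩ : TangentBundle (𝓡 k) P)).2) := by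
      filter_upwards [hnear] with y hy
      exact (e.linear ℝ hy).map_add (W y) (W' y)
    ext v
    simp only [mvfderiv, this.mfderiv_eq]
    rfl
  · intro W g x hW hg hp
    have hnear := e.open_baseSet.mem_nhds hp
    have : (fun y ↦ (e (⟨y, (g • W) y⟩ : TangentBundle (𝓡 k) P)).2) =ᶠ[nhds x]
        g • (fun y ↦ (e (⟨y, W y⟩ : TangentBundle (𝓡 k) P)).2) := by
      filter_upwards [hnear] with y hy
      exact (e.linear ℝ hy).map_smul (g y) (W y)
    have h2 : mvfderiv (𝓡 k) (fun y ↦ (e (⟨y, (g • W) y⟩ : TangentBundle (𝓡 k) P)).2) x =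
        mvfderiv (𝓡 k) (g • (fun y ↦ (e (⟨y, W y⟩ : TangentBundle (𝓡 k) P)).2)) x := by
      ext v
      simp only [mvfderiv, this.mfderiv_eq]
      rfl
    rw [h2, mvfderiv_smul hg (hdiff x W hp hW)]
    have h3 : e.symmL ℝ x (e (⟨x, W x⟩ : TangentBundle (𝓡 k) P)).2 = W x := by
      rw [← e.continuousLinearMapAt_apply_of_mem (R := ℝ) hp, e.symmL_continuousLinearMapAt hp]
    ext v : 1
    simp [h3]

/-- The derivative along `f` of the restriction to `M` of a field on `P` is the derivative of that
field in `P`. -/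
theorem covAlong_comp (D : LinearConnection k P) {f : M → P} {x : M}
    (hf : MDifferentiableAt (𝓡 n) (𝓡 k) f x) (W : Π z : P, TangentSpace (𝓡 k) z)
    (hW : MDifferentiableAt (𝓡 k) (𝓡 k).tangent
      (fun z ↦ (⟨z, W z⟩ : TangentBundle (𝓡 k) P)) (f x)) (u : TangentSpace (𝓡 n) x) :
    covAlong D f (fun y ↦ W (f y)) x u = D W (f x) (mfderiv (𝓡 n) (𝓡 k) f x u) := by
  set e := trivializationAt (EuclideanSpace ℝ (Fin k)) (TangentSpace (𝓡 k) : P → Type _) (f x)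
    with he
  have hp : f x ∈ e.baseSet := FiberBundle.mem_baseSet_trivializationAt' (f x)
  have hflat := isCovariantDerivativeOn_flat e
  have hE := FiberBundle.mdifferentiableAt_extend (𝓡 k) (EuclideanSpace ℝ (Fin k)) (W (f x))
  have hD : IsCovariantDerivativeOn (EuclideanSpace ℝ (Fin k)) D.toFun e.baseSet :=
    D.isCovariantDerivativeOn
  have h1 := IsCovariantDerivativeOn.difference_apply hD hflat hp hW
  have h2 := IsCovariantDerivativeOn.difference_apply hD hflat hp hE
  rw [FiberBundle.extend_apply_self, h1] at h2
  have h3 : mvfderiv (𝓡 k) (fun y ↦ (e (⟨y, FiberBundle.extend (EuclideanSpace ℝ (Fin k))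
      (W (f x)) y⟩ : TangentBundle (𝓡 k) P)).2) (f x) = 0 := by
    have : (fun y ↦ (e (⟨y, FiberBundle.extend (EuclideanSpace ℝ (Fin k))
        (W (f x)) y⟩ : TangentBundle (𝓡 k) P)).2) =ᶠ[nhds (f x)]
        fun _ ↦ (e (⟨f x, W (f x)⟩ : TangentBundle (𝓡 k) P)).2 := by
      filter_upwards [e.open_baseSet.mem_nhds hp] with y hy
      exact congrArg Prod.snd (a₁ := e (⟨y, FiberBundle.extend (EuclideanSpace ℝ (Fin k))
        (W (f x)) y⟩ : TangentBundle (𝓡 k) P))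
        (a₂ := (y, (e (⟨f x, W (f x)⟩ : TangentBundle (𝓡 k) P)).2)) (e.apply_mk_symm hy _)
    have h : mfderiv (𝓡 k) 𝓘(ℝ, EuclideanSpace ℝ (Fin k)) (fun y ↦ (e (⟨y,
        FiberBundle.extend (EuclideanSpace ℝ (Fin k)) (W (f x)) y⟩ :
          TangentBundle (𝓡 k) P)).2) (f x) = 0 := by
      rw [this.mfderiv_eq, mfderiv_const]
      rfl
    unfold mvfderiv
    rw [h]
    exact ContinuousLinearMap.comp_zero _
  have hc : mvfderiv (𝓡 n) (fun y ↦ (e (⟨f y, W (f y)⟩ : TangentBundle (𝓡 k) P)).2) x u =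
      mvfderiv (𝓡 k) (fun y ↦ (e (⟨y, W y⟩ : TangentBundle (𝓡 k) P)).2) (f x)
        (mfderiv (𝓡 n) (𝓡 k) f x u) :=
    mfderiv_comp_apply x ((e.mdifferentiableAt_section_iff (𝓡 k) W hp).1 hW) hf u
  rw [h3, ContinuousLinearMap.comp_zero, sub_zero] at h2
  have h4 := congrArg (fun L ↦ L (mfderiv (𝓡 n) (𝓡 k) f x u)) h2
  change e.symmL ℝ (f x)
    (mvfderiv (𝓡 n) (fun y ↦ (e (⟨f y, W (f y)⟩ : TangentBundle (𝓡 k) P)).2) x u) +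
    D (FiberBundle.extend (EuclideanSpace ℝ (Fin k)) (W (f x))) (f x)
      (mfderiv (𝓡 n) (𝓡 k) f x u) = _
  rw [← h4, hc]
  exact add_sub_cancel _ _

theorem covAlong_congr (D : LinearConnection k P) {f : M → P} {x : M}
    {V W : Π y : M, TangentSpace (𝓡 k) (f y)} (h : ∀ᶠ y in nhds x, V y = W y) :
    covAlong (n := n) D f V x = covAlong D f W x := by
  have h0 : V x = W x := h.self_of_nhds
  have h1 : (fun y ↦ (trivializationAt (EuclideanSpace ℝ (Fin k))
        (TangentSpace (𝓡 k) : P → Type _) (f x) (⟨f y, V y⟩ : TangentBundle (𝓡 k) P)).2) =ᶠ[nhds x]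
      (fun y ↦ (trivializationAt (EuclideanSpace ℝ (Fin k))
        (TangentSpace (𝓡 k) : P → Type _) (f x) (⟨f y, W y⟩ : TangentBundle (𝓡 k) P)).2) := by
    filter_upwards [h] with y hy
    rw [hy]
  unfold covAlong
  simp only [h0, mvfderiv, h1.mfderiv_eq]
  rfl

/-- The derivative along `f` is additive. -/
theorem covAlong_add (D : LinearConnection k P) {f : M → P} {x : M}
    (hf : ContinuousAt f x) {V W : Π y : M, TangentSpace (𝓡 k) (f y)}
    (hV : MDifferentiableAt (𝓡 n) (𝓡 k).tangent
      (fun y ↦ (⟨f y, V y⟩ : TangentBundle (𝓡 k) P)) x)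
    (hW : MDifferentiableAt (𝓡 n) (𝓡 k).tangent
      (fun y ↦ (⟨f y, W y⟩ : TangentBundle (𝓡 k) P)) x) :
    covAlong (n := n) D f (fun y ↦ V y + W y) x = covAlong D f V x + covAlong D f W x := by
  obtain ⟨e, he⟩ : ∃ e, e = trivializationAt (EuclideanSpace ℝ (Fin k))
    (TangentSpace (𝓡 k) : P → Type _) (f x) := ⟨_, rfl⟩
  have hp : f x ∈ e.baseSet := he ▸ FiberBundle.mem_baseSet_trivializationAt' (f x)
  have : MemTrivializationAtlas e := he ▸ inferInstance
  rw [mdifferentiableAt_totalSpace] at hV hW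
  have hext : D (FiberBundle.extend (EuclideanSpace ℝ (Fin k)) (V x + W x)) (f x) =
      D (FiberBundle.extend (EuclideanSpace ℝ (Fin k)) (V x)) (f x) +
        D (FiberBundle.extend (EuclideanSpace ℝ (Fin k)) (W x)) (f x) := by
    have hV' := FiberBundle.mdifferentiableAt_extend (𝓡 k) (EuclideanSpace ℝ (Fin k)) (V x)
    have hW' := FiberBundle.mdifferentiableAt_extend (𝓡 k) (EuclideanSpace ℝ (Fin k)) (W x)
    have hVW' := FiberBundle.mdifferentiableAt_extend (𝓡 k) (EuclideanSpace ℝ (Fin k)) (V x + W x)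
    have hD : IsCovariantDerivativeOn (EuclideanSpace ℝ (Fin k)) D.toFun Set.univ :=
      D.isCovariantDerivativeOn
    rw [← hD.add hV' hW']
    refine hD.congr_of_eventuallyEq hVW' (mdifferentiableAt_add_section hV' hW')
      Filter.univ_mem ?_
    filter_upwards [e.open_baseSet.mem_nhds hp] with z hz
    simp only [FiberBundle.extend, Pi.add_apply, ← he]
    rw [← e.symmL_apply (R := ℝ) hz, ← e.symmL_apply (R := ℝ) hz, ← e.symmL_apply (R := ℝ) hz,
      ← map_add]
    congr 1
    exact (e.linear ℝ hp).map_add (V x) (W x)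
  have hcoord : mvfderiv (𝓡 n) (fun y ↦ (e (⟨f y, V y + W y⟩ : TangentBundle (𝓡 k) P)).2) x =
      mvfderiv (𝓡 n) (fun y ↦ (e (⟨f y, V y⟩ : TangentBundle (𝓡 k) P)).2) x +
      mvfderiv (𝓡 n) (fun y ↦ (e (⟨f y, W y⟩ : TangentBundle (𝓡 k) P)).2) x := by
    have h : (fun y ↦ (e (⟨f y, V y + W y⟩ : TangentBundle (𝓡 k) P)).2) =ᶠ[nhds x]
        (fun y ↦ (e (⟨f y, V y⟩ : TangentBundle (𝓡 k) P)).2) +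
          (fun y ↦ (e (⟨f y, W y⟩ : TangentBundle (𝓡 k) P)).2) := by
      filter_upwards [hf (e.open_baseSet.mem_nhds hp)] with y hy
      exact (e.linear ℝ hy).map_add (V y) (W y)
    subst he
    rw [← mvfderiv_add hV.2 hW.2]
    ext v
    simp only [mvfderiv, h.mfderiv_eq]
    rfl
  unfold covAlong
  simp only [← he, hext]
  subst he
  rw [hcoord, ContinuousLinearMap.comp_add, ContinuousLinearMap.add_comp]
  abel

/-- The derivative along `f` satisfies the Leibniz rule. -/
theorem covAlong_smul (D : LinearConnection k P) {f : M → P} {x : M}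
    (hf : ContinuousAt f x) {V : Π y : M, TangentSpace (𝓡 k) (f y)} {a : M → ℝ}
    (ha : MDifferentiableAt (𝓡 n) 𝓘(ℝ, ℝ) a x)
    (hV : MDifferentiableAt (𝓡 n) (𝓡 k).tangent
      (fun y ↦ (⟨f y, V y⟩ : TangentBundle (𝓡 k) P)) x) :
    covAlong (n := n) D f (fun y ↦ a y • V y) x =
      a x • covAlong D f V x + (mvfderiv (𝓡 n) a x).smulRight (V x) := by
  obtain ⟨e, he⟩ : ∃ e, e = trivializationAt (EuclideanSpace ℝ (Fin k))
    (TangentSpace (𝓡 k) : P → Type _) (f x) := ⟨_, rfl⟩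
  have hp : f x ∈ e.baseSet := he ▸ FiberBundle.mem_baseSet_trivializationAt' (f x)
  have : MemTrivializationAtlas e := he ▸ inferInstance
  rw [mdifferentiableAt_totalSpace] at hV
  have hext : D (FiberBundle.extend (EuclideanSpace ℝ (Fin k)) (a x • V x)) (f x) =
      a x • D (FiberBundle.extend (EuclideanSpace ℝ (Fin k)) (V x)) (f x) := by
    have hV' := FiberBundle.mdifferentiableAt_extend (𝓡 k) (EuclideanSpace ℝ (Fin k)) (V x)
    have haV' := FiberBundle.mdifferentiableAt_extend (𝓡 k) (EuclideanSpace ℝ (Fin k)) (a x • V x)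
    have hD : IsCovariantDerivativeOn (EuclideanSpace ℝ (Fin k)) D.toFun Set.univ :=
      D.isCovariantDerivativeOn
    rw [← hD.smul_const (a x) hV']
    refine hD.congr_of_eventuallyEq haV' (hV'.smul_const_section (a := a x))
      Filter.univ_mem ?_
    filter_upwards [e.open_baseSet.mem_nhds hp] with z hz
    simp only [FiberBundle.extend, Pi.smul_apply, ← he]
    rw [← e.symmL_apply (R := ℝ) hz, ← e.symmL_apply (R := ℝ) hz, ← map_smul]
    congr 1
    exact (e.linear ℝ hp).map_smul (a x) (V x)
  have hcoord : mvfderiv (𝓡 n) (fun y ↦ (e (⟨f y, a y • V y⟩ : TangentBundle (𝓡 k) P)).2) x =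
      a x • mvfderiv (𝓡 n) (fun y ↦ (e (⟨f y, V y⟩ : TangentBundle (𝓡 k) P)).2) x +
      (mvfderiv (𝓡 n) a x).smulRight (e (⟨f x, V x⟩ : TangentBundle (𝓡 k) P)).2 := by
    have h : (fun y ↦ (e (⟨f y, a y • V y⟩ : TangentBundle (𝓡 k) P)).2) =ᶠ[nhds x]
        a • (fun y ↦ (e (⟨f y, V y⟩ : TangentBundle (𝓡 k) P)).2) := by
      filter_upwards [hf (e.open_baseSet.mem_nhds hp)] with y hy
      exact (e.linear ℝ hy).map_smul (a y) (V y)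
    subst he
    rw [← mvfderiv_smul ha hV.2]
    ext v
    simp only [mvfderiv, h.mfderiv_eq]
    rfl
  have h3 : e.symmL ℝ (f x) (e (⟨f x, V x⟩ : TangentBundle (𝓡 k) P)).2 = V x := by
    rw [← e.continuousLinearMapAt_apply_of_mem (R := ℝ) hp, e.symmL_continuousLinearMapAt hp]
  unfold covAlong
  simp only [← he, hext]
  subst he
  rw [hcoord]
  ext v : 1
  simp [h3]
  abel

end Along

section Induced

variable {n k : ℕ} {M : Type*} [TopologicalSpace M] [ChartedSpace (EuclideanSpace ℝ (Fin n)) M]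
  {P : Type*} [TopologicalSpace P] [ChartedSpace (EuclideanSpace ℝ (Fin k)) P]
  [RiemannianBundle (fun x : M ↦ TangentSpace (𝓡 n) x)]
  [RiemannianBundle (fun x : P ↦ TangentSpace (𝓡 k) x)]

variable [IsManifold (𝓡 k) ∞ P]

variable (n) in
/-- `N_1, …, N_r` is a smooth orthonormal frame of normal vector fields along `f`, on `U`. -/
structure IsNormalFrame {r : ℕ} (f : M → P) (U : Set M)
    (N : Fin r → Π x : M, TangentSpace (𝓡 k) (f x)) : Prop where
  smooth : ∀ α, ContMDiffOn (𝓡 n) (𝓡 k).tangent ∞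
    (fun x ↦ (⟨f x, N α x⟩ : TangentBundle (𝓡 k) P)) U
  orthonormal : ∀ x ∈ U, Orthonormal ℝ (fun α ↦ N α x)
  normal : ∀ x ∈ U, ∀ (α : Fin r) (u : TangentSpace (𝓡 n) x), inner ℝ (dmap f x u) (N α x) = 0

/-- `T u = (J u)ᵀ`. -/
def indT (J : Π z : P, TangentSpace (𝓡 k) z →L[ℝ] TangentSpace (𝓡 k) z) (f : M → P) (x : M)
    (u : TangentSpace (𝓡 n) x) : TangentSpace (𝓡 n) x :=
  tangentialPart f x (J (f x) (dmap f x u))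

/-- `η_ν(u) = g((J u)^⊥, ν)`. -/
def indEta (J : Π z : P, TangentSpace (𝓡 k) z →L[ℝ] TangentSpace (𝓡 k) z) (f : M → P)
    (ν : Π x : M, TangentSpace (𝓡 k) (f x)) (x : M) (u : TangentSpace (𝓡 n) x) : ℝ :=
  inner ℝ (normalPart (n := n) f x (J (f x) (dmap f x u))) (ν x)

/-- `ξ_ν = (J ν)ᵀ`. -/
def indXi (J : Π z : P, TangentSpace (𝓡 k) z →L[ℝ] TangentSpace (𝓡 k) z) (f : M → P)
    (ν : Π x : M, TangentSpace (𝓡 k) (f x)) (x : M) : TangentSpace (𝓡 n) x :=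
  tangentialPart f x (J (f x) (ν x))

variable (n) in
/-- `a_{νμ} = g((J ν)^⊥, μ)`. -/
def indA (J : Π z : P, TangentSpace (𝓡 k) z →L[ℝ] TangentSpace (𝓡 k) z) (f : M → P)
    (ν μ : Π x : M, TangentSpace (𝓡 k) (f x)) (x : M) : ℝ :=
  inner ℝ (normalPart (n := n) f x (J (f x) (ν x))) (μ x)

/-- The normal connection form `λ_{νμ}(u) = g(∇^⊥_u ν, μ)`, where `∇^⊥_u ν = (∇̄_u ν)^⊥`. -/
def normalForm (D : LinearConnection k P) (f : M → P)
    (ν μ : Π x : M, TangentSpace (𝓡 k) (f x)) (x : M) (u : TangentSpace (𝓡 n) x) : ℝ :=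
  inner ℝ (normalPart (n := n) f x (covAlong D f ν x u)) (μ x)

variable [IsManifold (𝓡 n) ∞ M]

/-- The second fundamental form `h(u, v) = (∇̄_u V)^⊥`, where `V` is a vector field on `M` with
`V x = v`, taken here constant in the trivialization of `TM` around `x`. -/
def secondForm (D : LinearConnection k P) (f : M → P) (x : M) (u v : TangentSpace (𝓡 n) x) :
    TangentSpace (𝓡 k) (f x) :=
  normalPart (n := n) f x (covAlong D f
    (fun y ↦ dmap (n := n) f y (FiberBundle.extend (EuclideanSpace ℝ (Fin n)) v y)) x u)

/-- `h_ν(u, v) = g(h(u, v), ν)` for a vector `ν ∈ T_{f x} P`. -/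
def secondFormAt (D : LinearConnection k P) (f : M → P) (x : M) (ν : TangentSpace (𝓡 k) (f x))
    (u v : TangentSpace (𝓡 n) x) : ℝ :=
  inner ℝ (secondForm D f x u v) ν

/-- The shape operator `A_ν`: the vector `A_ν u` with `g(A_ν u, v) = h_ν(u, v)` for all `v`,
written in an orthonormal basis of `T_x M`. -/
def shapeOp (D : LinearConnection k P) (f : M → P) (x : M) (ν : TangentSpace (𝓡 k) (f x))
    (u : TangentSpace (𝓡 n) x) : TangentSpace (𝓡 n) x :=
  ∑ i, secondFormAt D f x ν u (stdOrthonormalBasis ℝ (TangentSpace (𝓡 n) x) i) •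
    stdOrthonormalBasis ℝ (TangentSpace (𝓡 n) x) i

/-- The defining property of the shape operator. -/
theorem inner_shapeOp (D : LinearConnection k P) {f : M → P} (hf : ContMDiff (𝓡 n) (𝓡 k) ∞ f)
    (x : M) (ν : TangentSpace (𝓡 k) (f x)) (u v : TangentSpace (𝓡 n) x) :
    inner ℝ (shapeOp D f x ν u) v = secondFormAt D f x ν u v := by
  have hpush : ∀ v : TangentSpace (𝓡 n) x, MDifferentiableAt (𝓡 n) (𝓡 k).tangent
      (fun y ↦ (⟨f y, dmap (n := n) f y
        (FiberBundle.extend (EuclideanSpace ℝ (Fin n)) v y)⟩ : TangentBundle (𝓡 k) P)) x := by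
    intro v
    have h1 := FiberBundle.mdifferentiableAt_extend (𝓡 n) (EuclideanSpace ℝ (Fin n)) v
    have h2 : ContMDiff (𝓡 n).tangent (𝓡 k).tangent 1 (tangentMap (𝓡 n) (𝓡 k) f) :=
      hf.contMDiff_tangentMap (by norm_num; exact ENat.LEInfty.out)
    exact (h2.mdifferentiable one_ne_zero _).comp x h1
  have hf0 : ContinuousAt f x := hf.continuous.continuousAt
  have hp := FiberBundle.mem_baseSet_trivializationAt' (F := EuclideanSpace ℝ (Fin n))
    (E := (TangentSpace (𝓡 n) : M → Type _)) x
  have hnear := (trivializationAt (EuclideanSpace ℝ (Fin n))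
    (TangentSpace (𝓡 n) : M → Type _) x).open_baseSet.mem_nhds hp
  have hadd : ∀ v w, secondFormAt D f x ν u (v + w) =
      secondFormAt D f x ν u v + secondFormAt D f x ν u w := by
    intro v w
    have h : covAlong (n := n) D f (fun y ↦ dmap (n := n) f y
          (FiberBundle.extend (EuclideanSpace ℝ (Fin n)) (v + w) y)) x =
        covAlong (n := n) D f (fun y ↦ dmap (n := n) f y
          (FiberBundle.extend (EuclideanSpace ℝ (Fin n)) v y)) x +
        covAlong (n := n) D f (fun y ↦ dmap (n := n) f y
          (FiberBundle.extend (EuclideanSpace ℝ (Fin n)) w y)) x := by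
      rw [← covAlong_add D hf0 (hpush v) (hpush w)]
      refine covAlong_congr (n := n) D ?_
      filter_upwards [hnear] with y hy
      rw [← map_add]
      congr 1
      simp only [FiberBundle.extend]
      rw [← Trivialization.symmL_apply (R := ℝ) _ hy, ← Trivialization.symmL_apply (R := ℝ) _ hy,
        ← Trivialization.symmL_apply (R := ℝ) _ hy, ← map_add]
      congr 1
      exact (Trivialization.linear ℝ _ hp).map_add v w
    simp only [secondFormAt, secondForm, h, add_apply, normalPart, map_add,
      inner_sub_left, inner_add_left]
    ring
  have hsmul : ∀ (c : ℝ) v, secondFormAt D f x ν u (c • v) = c * secondFormAt D f x ν u v := by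
    intro c v
    have h : covAlong (n := n) D f (fun y ↦ dmap (n := n) f y
          (FiberBundle.extend (EuclideanSpace ℝ (Fin n)) (c • v) y)) x =
        c • covAlong (n := n) D f (fun y ↦ dmap (n := n) f y
          (FiberBundle.extend (EuclideanSpace ℝ (Fin n)) v y)) x := by
      have h1 := covAlong_smul D hf0 (a := fun _ ↦ c) mdifferentiableAt_const (hpush v)
      rw [mvfderiv_const] at h1
      rw [show c • covAlong (n := n) D f (fun y ↦ dmap (n := n) f y
          (FiberBundle.extend (EuclideanSpace ℝ (Fin n)) v y)) x = _ from
        (h1.trans (by ext; simp)).symm]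
      refine covAlong_congr (n := n) D ?_
      filter_upwards [hnear] with y hy
      rw [← map_smul]
      congr 1
      simp only [FiberBundle.extend]
      rw [← Trivialization.symmL_apply (R := ℝ) _ hy, ← Trivialization.symmL_apply (R := ℝ) _ hy,
        ← map_smul]
      congr 1
      exact (Trivialization.linear ℝ _ hp).map_smul c v
    simp only [secondFormAt, secondForm, h, smul_apply, normalPart, map_smul,
      inner_sub_left, inner_smul_left]
    simp
    ring
  let L : TangentSpace (𝓡 n) x →ₗ[ℝ] ℝ :=
    { toFun := fun v ↦ secondFormAt D f x ν u v
      map_add' := hadd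
      map_smul' := hsmul }
  have hL : ∀ v, secondFormAt D f x ν u v = L v := fun _ ↦ rfl
  conv_rhs => rw [hL, ← (stdOrthonormalBasis ℝ (TangentSpace (𝓡 n) x)).sum_repr' v, map_sum]
  rw [shapeOp, sum_inner]
  refine Finset.sum_congr rfl fun i _ ↦ ?_
  rw [inner_smul_left, map_smul, hL]
  simp [mul_comm]

end Induced

end MetallicSubmanifold

end

open MetallicSubmanifold

/-! Since `J` is parallel on the ambient manifold, `∇̄_u (J V) = J (∇̄_u V)` for every
differentiable field `V` along `f` (`covAlong_endo`). Taking `V = df Y` and `V = N_α` gives two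
identities between ambient vectors. On the right-hand sides the Gauss formula (`covAlong_dmap`) and
the Weingarten formula (`IsNormalFrame.covAlong_eq`) expand `∇̄_u V`. On the left, two formulas
valid for any `V` along `f` extract the tangential part (`IsNormalFrame.tangentialPart_covAlong`)
and the components along the frame (`IsNormalFrame.mvfderiv_inner`). With `V = df Y` these give the
derivatives of `T` and `η_α`; with `V = N_α`, those of `ξ_α` and `a_{αβ}`. Symmetry of `J` makes `a`
symmetric and `η_α` dual to `ξ_α`; orthonormality of the frame makes `λ` skew.

The groundwork is calculus along `f`. A field along `f` need not be the restriction of an ambient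
field, but locally it is a combination of such restrictions with coefficients functions on `M`, so
`MDiffAlong.induction` transfers parallelism and metric compatibility from the ambient connection.
The Gauss formula rests on uniqueness of the Levi-Civita connection: the tangential part of `∇̄` and
`∇` are both metric, and symmetric on coordinate fields, the former because the Hessian of `f` in
charts is symmetric. Differentiability of tangential parts follows by inverting a Gram matrix. -/

namespace MetallicSubmanifold

/-! ### Derivatives depend only on germs. -/

section Germ

variable {n : ℕ} {M : Type*} [TopologicalSpace M] [ChartedSpace (EuclideanSpace ℝ (Fin n)) M]

theorem mvfderiv_apply_congr {x : M} {g h : M → ℝ} (hgh : g =ᶠ[nhds x] h)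
    (u : TangentSpace (𝓡 n) x) :
    mvfderiv (𝓡 n) g x u = mvfderiv (𝓡 n) h x u := by
  simp only [mvfderiv, hgh.mfderiv_eq]
  rfl

end Germ

/-! ### Calculus of vector fields along a map. -/

section Along

variable {n k : ℕ} {M : Type*} [TopologicalSpace M] [ChartedSpace (EuclideanSpace ℝ (Fin n)) M]
  {P : Type*} [TopologicalSpace P] [ChartedSpace (EuclideanSpace ℝ (Fin k)) P]
  [IsManifold (𝓡 k) ∞ P]

variable (n) in
/-- The vector field `V` along `f` is differentiable at `x`. -/
def MDiffAlong (f : M → P) (V : Π x : M, TangentSpace (𝓡 k) (f x)) (x : M) : Prop :=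
  MDifferentiableAt (𝓡 n) (𝓡 k).tangent (fun y ↦ (⟨f y, V y⟩ : TangentBundle (𝓡 k) P)) x

variable {f : M → P} {x : M}

namespace MDiffAlong

theorem mdifferentiableAt_coord {V : Π x : M, TangentSpace (𝓡 k) (f x)}
    (hV : MDiffAlong n f V x) :
    MDifferentiableAt (𝓡 n) 𝓘(ℝ, EuclideanSpace ℝ (Fin k)) (fun y ↦
      (trivializationAt (EuclideanSpace ℝ (Fin k)) (TangentSpace (𝓡 k) : P → Type _) (f x)
        (⟨f y, V y⟩ : TangentBundle (𝓡 k) P)).2) x :=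
  ((mdifferentiableAt_totalSpace _ _).1 hV).2

theorem mdifferentiableAt_base {V : Π x : M, TangentSpace (𝓡 k) (f x)}
    (hV : MDiffAlong n f V x) : MDifferentiableAt (𝓡 n) (𝓡 k) f x :=
  ((mdifferentiableAt_totalSpace _ _).1 hV).1

theorem congr {V W : Π x : M, TangentSpace (𝓡 k) (f x)}
    (hV : MDiffAlong n f V x) (h : ∀ᶠ y in nhds x, V y = W y) : MDiffAlong n f W x := by
  refine MDifferentiableAt.congr_of_eventuallyEq hV ?_
  filter_upwards [h] with y hy
  rw [hy]

theorem add {V W : Π x : M, TangentSpace (𝓡 k) (f x)}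
    (hV : MDiffAlong n f V x) (hW : MDiffAlong n f W x) :
    MDiffAlong n f (fun y ↦ V y + W y) x := by
  have hf := hV.mdifferentiableAt_base
  refine (mdifferentiableAt_totalSpace _ _).2 ⟨hf, ?_⟩
  refine (hV.mdifferentiableAt_coord.add hW.mdifferentiableAt_coord).congr_of_eventuallyEq ?_
  filter_upwards [hf.continuousAt.preimage_mem_nhds ((trivializationAt (EuclideanSpace ℝ (Fin k))
    (TangentSpace (𝓡 k) : P → Type _) (f x)).open_baseSet.mem_nhds
      (FiberBundle.mem_baseSet_trivializationAt' (f x)))] with y hy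
  exact (Trivialization.linear ℝ _ hy).map_add (V y) (W y)

theorem smul {a : M → ℝ} {V : Π x : M, TangentSpace (𝓡 k) (f x)}
    (hV : MDiffAlong n f V x) (ha : MDifferentiableAt (𝓡 n) 𝓘(ℝ, ℝ) a x) :
    MDiffAlong n f (fun y ↦ a y • V y) x := by
  have hf := hV.mdifferentiableAt_base
  refine (mdifferentiableAt_totalSpace _ _).2 ⟨hf, ?_⟩
  refine (ha.smul hV.mdifferentiableAt_coord).congr_of_eventuallyEq ?_
  filter_upwards [hf.continuousAt.preimage_mem_nhds ((trivializationAt (EuclideanSpace ℝ (Fin k))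
    (TangentSpace (𝓡 k) : P → Type _) (f x)).open_baseSet.mem_nhds
      (FiberBundle.mem_baseSet_trivializationAt' (f x)))] with y hy
  exact (Trivialization.linear ℝ _ hy).map_smul (a y) (V y)

theorem comp {W : Π z : P, TangentSpace (𝓡 k) z} (hf : MDifferentiableAt (𝓡 n) (𝓡 k) f x)
    (hW : MDifferentiableAt (𝓡 k) (𝓡 k).tangent
      (fun z ↦ (⟨z, W z⟩ : TangentBundle (𝓡 k) P)) (f x)) :
    MDiffAlong n f (fun y ↦ W (f y)) x :=
  MDifferentiableAt.comp x hW hf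

theorem zero (hf : MDifferentiableAt (𝓡 n) (𝓡 k) f x) :
    MDiffAlong n f (k := k) (fun _ ↦ 0) x :=
  comp (k := k) (W := fun _ ↦ 0) hf (mdifferentiableAt_zeroSection ℝ _)

theorem sum {ι : Type*} {s : Finset ι} {V : ι → Π x : M, TangentSpace (𝓡 k) (f x)}
    (hf : MDifferentiableAt (𝓡 n) (𝓡 k) f x) (hV : ∀ i ∈ s, MDiffAlong n f (V i) x) :
    MDiffAlong n f (fun y ↦ ∑ i ∈ s, V i y) x := by
  classical
  induction s using Finset.induction_on with
  | empty => simpa using zero hf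
  | insert i s hi ih =>
    simp only [Finset.sum_insert hi]
    exact (hV i (by simp)).add (ih fun j hj ↦ hV j (by simp [hj]))

/-- A property of differentiable vector fields along `f` which is local, stable under addition and
multiplication by functions, and holds for restrictions of vector fields on the target, holds for
all of them. -/
theorem induction {Q : (Π x : M, TangentSpace (𝓡 k) (f x)) → Prop}
    (hcongr : ∀ V W, MDiffAlong n f V x → (∀ᶠ y in nhds x, V y = W y) → Q V → Q W)
    (hadd : ∀ V W, MDiffAlong n f V x → MDiffAlong n f W x → Q V → Q W → Q fun y ↦ V y + W y)
    (hsmul : ∀ (a : M → ℝ) V, MDifferentiableAt (𝓡 n) 𝓘(ℝ, ℝ) a x → MDiffAlong n f V x → Q V →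
      Q fun y ↦ a y • V y)
    (hcomp : ∀ W : Π z : P, TangentSpace (𝓡 k) z, MDifferentiableAt (𝓡 k) (𝓡 k).tangent
      (fun z ↦ (⟨z, W z⟩ : TangentBundle (𝓡 k) P)) (f x) → Q fun y ↦ W (f y))
    {V : Π x : M, TangentSpace (𝓡 k) (f x)} (hV : MDiffAlong n f V x) : Q V := by
  classical
  have hf := hV.mdifferentiableAt_base
  have hc := hV.mdifferentiableAt_coord
  set e := trivializationAt (EuclideanSpace ℝ (Fin k)) (TangentSpace (𝓡 k) : P → Type _) (f x)
  have hp : f x ∈ e.baseSet := FiberBundle.mem_baseSet_trivializationAt' (f x)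
  let b := (EuclideanSpace.basisFun (Fin k) ℝ).toBasis
  -- Near `x`, `V = ∑ a i • E_i ∘ f`, where `E_i` is the local frame of `TP` given by the
  -- trivialization: the coefficients live on `M`, the frame on `P`.
  let a : Fin k → M → ℝ := fun i y ↦ (e (⟨f y, V y⟩ : TangentBundle (𝓡 k) P)).2 i
  have ha : ∀ i, MDifferentiableAt (𝓡 n) 𝓘(ℝ, ℝ) (a i) x := fun i ↦
    ((EuclideanSpace.proj i : EuclideanSpace ℝ (Fin k) →L[ℝ] ℝ).mdifferentiableAt).comp x hc
  have hW : ∀ i, MDifferentiableAt (𝓡 k) (𝓡 k).tangent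
      (fun z ↦ (⟨z, e.localFrame b i z⟩ : TangentBundle (𝓡 k) P)) (f x) := fun i ↦
    (contMDiffAt_localFrame_of_mem (n := 1) e b i hp).mdifferentiableAt one_ne_zero
  have hterm : ∀ i, MDiffAlong n f (fun y ↦ a i y • e.localFrame b i (f y)) x := fun i ↦
    (comp hf (hW i)).smul (ha i)
  have hsum : ∀ s : Finset (Fin k), Q fun y ↦ ∑ i ∈ s, a i y • e.localFrame b i (f y) := by
    intro s
    induction s using Finset.induction_on with
    | empty => simpa using hcomp (fun _ ↦ 0) (mdifferentiableAt_zeroSection ℝ _)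
    | insert i s hi ih =>
      simp only [Finset.sum_insert hi]
      exact hadd _ _ (hterm i) (sum hf fun j _ ↦ hterm j)
        (hsmul _ _ (ha i) (comp hf (hW i)) (hcomp _ (hW i))) ih
  refine hcongr _ _ (sum hf fun i _ ↦ hterm i) ?_ (hsum Finset.univ)
  filter_upwards [hf.continuousAt.preimage_mem_nhds (e.open_baseSet.mem_nhds hp)] with y hy
  have hy : f y ∈ e.baseSet := hy
  conv_rhs => rw [← (e.basisAt b hy).sum_repr (V y)]
  refine Finset.sum_congr rfl fun i _ ↦ ?_
  rw [Trivialization.localFrame_apply_of_mem_baseSet e b hy]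
  rfl

end MDiffAlong

theorem covAlong_apply (D : LinearConnection k P) (f : M → P)
    (V : Π x : M, TangentSpace (𝓡 k) (f x)) (x : M) (u : TangentSpace (𝓡 n) x) :
    covAlong D f V x u =
      (trivializationAt (EuclideanSpace ℝ (Fin k)) (TangentSpace (𝓡 k) : P → Type _) (f x)).symmL ℝ
        (f x) (mvfderiv (𝓡 n) (fun y ↦ (trivializationAt (EuclideanSpace ℝ (Fin k))
          (TangentSpace (𝓡 k) : P → Type _) (f x) (⟨f y, V y⟩ : TangentBundle (𝓡 k) P)).2) x u) +
      D (FiberBundle.extend (EuclideanSpace ℝ (Fin k)) (V x)) (f x)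
        (mfderiv (𝓡 n) (𝓡 k) f x u) :=
  rfl

theorem covAlong_zero (D : LinearConnection k P) (hf : MDifferentiableAt (𝓡 n) (𝓡 k) f x) :
    covAlong (n := n) (k := k) D f (fun _ ↦ 0) x = 0 := by
  have h := covAlong_smul (n := n) D hf.continuousAt (V := fun _ ↦ 0) (a := fun _ ↦ 0)
    mdifferentiableAt_const (MDiffAlong.zero hf)
  simp only [smul_zero, zero_smul, zero_add, mvfderiv_const] at h
  rw [h]
  ext
  simp

theorem covAlong_sum (D : LinearConnection k P) (hf : MDifferentiableAt (𝓡 n) (𝓡 k) f x)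
    {ι : Type*} {s : Finset ι} {V : ι → Π x : M, TangentSpace (𝓡 k) (f x)}
    (hV : ∀ i ∈ s, MDiffAlong n f (V i) x) :
    covAlong (n := n) D f (fun y ↦ ∑ i ∈ s, V i y) x = ∑ i ∈ s, covAlong D f (V i) x := by
  classical
  induction s using Finset.induction_on with
  | empty => simpa using covAlong_zero D hf
  | insert i s hi ih =>
    simp only [Finset.sum_insert hi]
    rw [covAlong_add D hf.continuousAt (hV i (by simp))
      (MDiffAlong.sum hf fun j hj ↦ hV j (by simp [hj])), ih fun j hj ↦ hV j (by simp [hj])]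

theorem covAlong_add_apply (D : LinearConnection k P) {V W : Π x : M, TangentSpace (𝓡 k) (f x)}
    (hV : MDiffAlong n f V x) (hW : MDiffAlong n f W x) (u : TangentSpace (𝓡 n) x) :
    covAlong D f (fun y ↦ V y + W y) x u = covAlong D f V x u + covAlong D f W x u := by
  rw [covAlong_add D hV.mdifferentiableAt_base.continuousAt hV hW]
  rfl

theorem covAlong_smul_apply (D : LinearConnection k P) {V : Π x : M, TangentSpace (𝓡 k) (f x)}
    {a : M → ℝ} (ha : MDifferentiableAt (𝓡 n) 𝓘(ℝ, ℝ) a x) (hV : MDiffAlong n f V x)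
    (u : TangentSpace (𝓡 n) x) :
    covAlong D f (fun y ↦ a y • V y) x u =
      a x • covAlong D f V x u + mvfderiv (𝓡 n) a x u • V x := by
  rw [covAlong_smul D hV.mdifferentiableAt_base.continuousAt ha hV]
  rfl

/-- A field of endomorphisms which is parallel for `D` is parallel along every map. -/
theorem covAlong_endo (D : LinearConnection k P)
    {J : Π z : P, TangentSpace (𝓡 k) z →L[ℝ] TangentSpace (𝓡 k) z}
    (hJ : ContMDiff (𝓡 k) ((𝓡 k).prod 𝓘(ℝ, EuclideanSpace ℝ (Fin k) →L[ℝ] EuclideanSpace ℝ (Fin k)))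
      ∞ (fun z ↦ TotalSpace.mk' (EuclideanSpace ℝ (Fin k) →L[ℝ] EuclideanSpace ℝ (Fin k))
        (E := fun z : P ↦ TangentSpace (𝓡 k) z →L[ℝ] TangentSpace (𝓡 k) z) z (J z)))
    (hpar : ∀ (Y : Π z : P, TangentSpace (𝓡 k) z) (z : P) (u : TangentSpace (𝓡 k) z),
      MDifferentiableAt (𝓡 k) (𝓡 k).tangent (fun y ↦ (⟨y, Y y⟩ : TangentBundle (𝓡 k) P)) z →
      covDerivEndo D (fun y ↦ J y) Y z u = 0)
    {V : Π x : M, TangentSpace (𝓡 k) (f x)} (hV : MDiffAlong n f V x) (u : TangentSpace (𝓡 n) x) :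
    MDiffAlong n f (fun y ↦ J (f y) (V y)) x ∧
      covAlong D f (fun y ↦ J (f y) (V y)) x u = J (f x) (covAlong D f V x u) := by
  have hf := hV.mdifferentiableAt_base
  have hJ' := fun z ↦ (hJ.mdifferentiable (by simp)) z
  -- Differentiability of `J V` is carried through the induction because the sum and Leibniz rules
  -- for `J V` need it.
  refine MDiffAlong.induction (Q := fun V ↦ MDiffAlong n f (fun y ↦ J (f y) (V y)) x ∧
      covAlong D f (fun y ↦ J (f y) (V y)) x u = J (f x) (covAlong D f V x u)) ?_ ?_ ?_ ?_ hV
  · rintro V W hV h ⟨h1, h2⟩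
    have h' : ∀ᶠ y in nhds x, J (f y) (V y) = J (f y) (W y) := h.mono fun y hy ↦ by rw [hy]
    refine ⟨h1.congr h', ?_⟩
    rw [← covAlong_congr D h', h2, covAlong_congr D h]
  · rintro V W hV hW ⟨h1, h2⟩ ⟨h3, h4⟩
    simp only [map_add]
    refine ⟨h1.add h3, ?_⟩
    rw [covAlong_add_apply D h1 h3, h2, h4, covAlong_add_apply D hV hW, map_add]
  · rintro a V ha hV ⟨h1, h2⟩
    simp only [map_smul]
    refine ⟨h1.smul ha, ?_⟩
    rw [covAlong_smul_apply D ha h1, h2, covAlong_smul_apply D ha hV, map_add, map_smul, map_smul]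
  · intro W hW
    have hJW := (hJ' (f x)).clm_bundle_apply hW
    refine ⟨MDiffAlong.comp (W := fun z ↦ J z (W z)) hf hJW, ?_⟩
    rw [covAlong_comp D hf (fun z ↦ J z (W z)) hJW, covAlong_comp D hf W hW]
    exact sub_eq_zero.1 (hpar W (f x) (mfderiv (𝓡 n) (𝓡 k) f x u) hW)

variable [RiemannianBundle (fun z : P ↦ TangentSpace (𝓡 k) z)]
  [IsContMDiffRiemannianBundle (𝓡 k) ∞ (EuclideanSpace ℝ (Fin k))
    (fun z : P ↦ TangentSpace (𝓡 k) z)]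

theorem MDiffAlong.inner {V W : Π x : M, TangentSpace (𝓡 k) (f x)}
    (hV : MDiffAlong n f V x) (hW : MDiffAlong n f W x) :
    MDifferentiableAt (𝓡 n) 𝓘(ℝ, ℝ) (fun y ↦ inner ℝ (V y) (W y)) x :=
  MDifferentiableAt.inner_bundle hV hW

/-- A metric connection is metric along every map. -/
theorem mvfderiv_inner_along {D : LinearConnection k P} (hD : D.IsMetricCompatible)
    {V W : Π x : M, TangentSpace (𝓡 k) (f x)}
    (hV : MDiffAlong n f V x) (hW : MDiffAlong n f W x) (u : TangentSpace (𝓡 n) x) :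
    mvfderiv (𝓡 n) (fun y ↦ inner ℝ (V y) (W y)) x u =
      inner ℝ (covAlong D f V x u) (W x) + inner ℝ (V x) (covAlong D f W x u) := by
  have hf := hV.mdifferentiableAt_base
  refine MDiffAlong.induction (Q := fun V ↦ mvfderiv (𝓡 n) (fun y ↦ inner ℝ (V y) (W y)) x u =
      inner ℝ (covAlong D f V x u) (W x) + inner ℝ (V x) (covAlong D f W x u)) ?_ ?_ ?_ ?_ hV
  · intro V V' hV h hQ
    rw [← covAlong_congr D h, ← h.self_of_nhds, ← hQ]
    exact mvfderiv_apply_congr (h.mono fun y hy ↦ by simp only [hy]) u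
  · intro V V' hV hV' hQ hQ'
    simp only [inner_add_left]
    rw [mvfderiv_fun_add (hV.inner hW) (hV'.inner hW), add_apply, hQ, hQ',
      covAlong_add_apply D hV hV', inner_add_left]
    ring
  · intro a V ha hV hQ
    simp only [real_inner_smul_left]
    rw [mvfderiv_fun_mul ha (hV.inner hW), covAlong_smul_apply D ha hV]
    simp only [add_apply, smul_apply, hQ, inner_add_left, real_inner_smul_left, smul_eq_mul]
    ring
  · intro Z hZ
    have hZ' : MDiffAlong n f (fun y ↦ Z (f y)) x := MDiffAlong.comp hf hZ
    -- With the first field now a restriction `Z ∘ f`, a second induction reduces the other field to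
    -- a restriction as well.
    refine MDiffAlong.induction (Q := fun W ↦
      mvfderiv (𝓡 n) (fun y ↦ inner ℝ (Z (f y)) (W y)) x u =
      inner ℝ (covAlong D f (fun y ↦ Z (f y)) x u) (W x) +
        inner ℝ (Z (f x)) (covAlong D f W x u)) ?_ ?_ ?_ ?_ hW
    · intro V V' hV h hQ
      rw [← covAlong_congr D h, ← h.self_of_nhds, ← hQ]
      exact mvfderiv_apply_congr (h.mono fun y hy ↦ by simp only [hy]) u
    · intro V V' hV hV' hQ hQ'
      simp only [inner_add_right]
      rw [mvfderiv_fun_add (hZ'.inner hV) (hZ'.inner hV'), add_apply, hQ, hQ',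
        covAlong_add_apply D hV hV', inner_add_right]
      ring
    · intro a V ha hV hQ
      simp only [real_inner_smul_right]
      rw [mvfderiv_fun_mul ha (hZ'.inner hV), covAlong_smul_apply D ha hV]
      simp only [add_apply, smul_apply, hQ, inner_add_right, real_inner_smul_right, smul_eq_mul]
      ring
    · intro Z' hZ2
      rw [covAlong_comp D hf Z hZ, covAlong_comp D hf Z' hZ2]
      have h1 : mvfderiv (𝓡 n) (fun y ↦ inner ℝ (Z (f y)) (Z' (f y))) x u =
          mvfderiv (𝓡 k) (fun z ↦ inner ℝ (Z z) (Z' z)) (f x) (mfderiv (𝓡 n) (𝓡 k) f x u) :=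
        mfderiv_comp_apply x (MDifferentiableAt.inner_bundle hZ hZ2) hf u
      rw [h1]
      classical
      -- Metric compatibility takes a vector field as direction, but only its value at `f x`
      -- matters; hence the field equal to `df u` there and zero elsewhere.
      have h2 := hD.mvfderiv_inner_eq
        (Function.update (fun _ ↦ 0) (f x) (mfderiv (𝓡 n) (𝓡 k) f x u)) hZ hZ2
      simpa using h2

end Along

/-! ### Coordinate vector fields and torsion. -/

section Coordinates

variable {n : ℕ} {M : Type*} [TopologicalSpace M] [ChartedSpace (EuclideanSpace ℝ (Fin n)) M]
  [IsManifold (𝓡 n) ∞ M]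

/-- In the chart at `x`, the field `extend v` is constant. -/
theorem mfderiv_extChartAt_extend {x y : M} (hy : y ∈ (extChartAt (𝓡 n) x).source)
    (v : TangentSpace (𝓡 n) x) :
    mfderiv (𝓡 n) 𝓘(ℝ, EuclideanSpace ℝ (Fin n)) (extChartAt (𝓡 n) x) y
        (FiberBundle.extend (EuclideanSpace ℝ (Fin n)) v y) =
      mfderiv (𝓡 n) 𝓘(ℝ, EuclideanSpace ℝ (Fin n)) (extChartAt (𝓡 n) x) x v := by
  have hy' : y ∈ (chartAt (EuclideanSpace ℝ (Fin n)) x).source := by simpa using hy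
  have hx' : x ∈ (chartAt (EuclideanSpace ℝ (Fin n)) x).source := mem_chart_source _ x
  -- The trivialization of `TM` at `x` is the differential of the chart at `x`, and `extend v` is
  -- constant in that trivialization.
  rw [← TangentBundle.continuousLinearMapAt_trivializationAt hy',
    ← TangentBundle.continuousLinearMapAt_trivializationAt hx']
  have hyb : y ∈ (trivializationAt (EuclideanSpace ℝ (Fin n))
    (TangentSpace (𝓡 n) : M → Type _) x).baseSet := hy'
  have hxb : x ∈ (trivializationAt (EuclideanSpace ℝ (Fin n))
    (TangentSpace (𝓡 n) : M → Type _) x).baseSet := hx'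
  simp only [FiberBundle.extend]
  rw [← Trivialization.symmL_apply (R := ℝ) _ hyb]
  exact (Trivialization.continuousLinearMapAt_symmL _ hyb _).trans
    (Trivialization.continuousLinearMapAt_apply_of_mem (R := ℝ) _ hxb _).symm

/-- Read in the chart at `x`, both fields are constant near the image of `x`, so their bracket
vanishes there. -/
theorem mlieBracket_extend (x : M) (u v : TangentSpace (𝓡 n) x) :
    VectorField.mlieBracket (𝓡 n) (FiberBundle.extend (EuclideanSpace ℝ (Fin n)) u)
      (FiberBundle.extend (EuclideanSpace ℝ (Fin n)) v) x = 0 := by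
  have key : ∀ w : TangentSpace (𝓡 n) x,
      (VectorField.mpullbackWithin 𝓘(ℝ, EuclideanSpace ℝ (Fin n)) (𝓡 n) (extChartAt (𝓡 n) x).symm
        (FiberBundle.extend (EuclideanSpace ℝ (Fin n)) w) (Set.range (𝓡 n)) :
          EuclideanSpace ℝ (Fin n) → EuclideanSpace ℝ (Fin n)) =ᶠ[nhds (extChartAt (𝓡 n) x x)]
      fun _ ↦ mfderiv (𝓡 n) 𝓘(ℝ, EuclideanSpace ℝ (Fin n)) (extChartAt (𝓡 n) x) x w := by
    intro w
    filter_upwards [extChartAt_target_mem_nhds (I := 𝓡 n) x] with z hz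
    rw [VectorField.mpullbackWithin_apply,
      ← mfderiv_extChartAt_extend ((extChartAt (𝓡 n) x).map_target hz) w]
    have hinv := isInvertible_mfderivWithin_extChartAt_symm (I := 𝓡 n) hz
    exact hinv.inverse_apply_eq.2 (congrArg (fun L ↦ L (FiberBundle.extend (EuclideanSpace ℝ (Fin n)) w
      ((extChartAt (𝓡 n) x).symm z)))
      (mfderivWithin_extChartAt_symm_comp_mfderiv_extChartAt (I := 𝓡 n) hz)).symm
  rw [← VectorField.mlieBracketWithin_univ, VectorField.mlieBracketWithin_apply]
  have h0 : VectorField.lieBracketWithin ℝ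
      (VectorField.mpullbackWithin 𝓘(ℝ, EuclideanSpace ℝ (Fin n)) (𝓡 n) (extChartAt (𝓡 n) x).symm
        (FiberBundle.extend (EuclideanSpace ℝ (Fin n)) u) (Set.range (𝓡 n)) :
          EuclideanSpace ℝ (Fin n) → EuclideanSpace ℝ (Fin n))
      (VectorField.mpullbackWithin 𝓘(ℝ, EuclideanSpace ℝ (Fin n)) (𝓡 n) (extChartAt (𝓡 n) x).symm
        (FiberBundle.extend (EuclideanSpace ℝ (Fin n)) v) (Set.range (𝓡 n)) :
          EuclideanSpace ℝ (Fin n) → EuclideanSpace ℝ (Fin n))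
      Set.univ (extChartAt (𝓡 n) x x) = 0 := by
    have hconst : ∀ (V W : EuclideanSpace ℝ (Fin n) → EuclideanSpace ℝ (Fin n))
        (a b p : EuclideanSpace ℝ (Fin n)), V =ᶠ[nhds p] (fun _ ↦ a) → W =ᶠ[nhds p] (fun _ ↦ b) →
        VectorField.lieBracketWithin ℝ V W Set.univ p = 0 := by
      intro V W a b p hV hW
      rw [VectorField.lieBracketWithin_univ, VectorField.lieBracket_eq]
      simp only [hV.fderiv_eq, hW.fderiv_eq]
      simp
    exact hconst _ _ _ _ _ (key u) (key v)
  have hs : (extChartAt (𝓡 n) x).symm ⁻¹' Set.univ ∩ Set.range (𝓡 n) = Set.univ := by simp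
  rw [hs]
  exact (congrArg _ h0).trans (map_zero _)

/-- A torsion-free connection is symmetric on coordinate fields. -/
theorem torsionFree_extend_symm {D : LinearConnection n M} (hD : D.torsion = 0) (x : M)
    (u v : TangentSpace (𝓡 n) x) :
    D (FiberBundle.extend (EuclideanSpace ℝ (Fin n)) v) x u =
      D (FiberBundle.extend (EuclideanSpace ℝ (Fin n)) u) x v := by
  have h := (CovariantDerivative.torsion_eq_zero_iff D).1 hD
    (FiberBundle.mdifferentiableAt_extend (𝓡 n) (EuclideanSpace ℝ (Fin n)) u)
    (FiberBundle.mdifferentiableAt_extend (𝓡 n) (EuclideanSpace ℝ (Fin n)) v)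
  rw [mlieBracket_extend, FiberBundle.extend_apply_self, FiberBundle.extend_apply_self] at h
  exact sub_eq_zero.1 h

end Coordinates

/-! ### Symmetry of the second derivative of a smooth map. -/

section Immersion

variable {n k : ℕ} {M : Type*} [TopologicalSpace M] [ChartedSpace (EuclideanSpace ℝ (Fin n)) M]
  [IsManifold (𝓡 n) ∞ M]
  {P : Type*} [TopologicalSpace P] [ChartedSpace (EuclideanSpace ℝ (Fin k)) P]
  [IsManifold (𝓡 k) ∞ P] {f : M → P}

/-- The differential of a smooth map sends differentiable vector fields to differentiable vector
fields along the map. -/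
theorem mdiffAlong_dmap (hf : ContMDiff (𝓡 n) (𝓡 k) ∞ f) {x : M}
    {Y : Π x : M, TangentSpace (𝓡 n) x}
    (hY : MDifferentiableAt (𝓡 n) (𝓡 n).tangent (fun y ↦ (⟨y, Y y⟩ : TangentBundle (𝓡 n) M)) x) :
    MDiffAlong n f (fun y ↦ dmap (n := n) (k := k) f y (Y y)) x := by
  have h2 : ContMDiff (𝓡 n).tangent (𝓡 k).tangent 1 (tangentMap (𝓡 n) (𝓡 k) f) :=
    hf.contMDiff_tangentMap (by norm_num; exact ENat.LEInfty.out)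
  exact (h2.mdifferentiable one_ne_zero _).comp x hY

/-- With `F` the expression of `f` in charts, `df ∂_v` has fibre coordinates `DF(φ y) v̂`, where `φ`
is the chart at `x` and `v̂ = dφ v`; one more derivative gives the Hessian of `F`. It serves to
exchange `u` and `v`. -/
theorem mvfderiv_coord_dmap_extend (hf : ContMDiff (𝓡 n) (𝓡 k) ∞ f) (x : M)
    (u v : TangentSpace (𝓡 n) x) :
    mvfderiv (𝓡 n) (fun y ↦ (trivializationAt (EuclideanSpace ℝ (Fin k))
        (TangentSpace (𝓡 k) : P → Type _) (f x) (⟨f y, dmap (n := n) f y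
          (FiberBundle.extend (EuclideanSpace ℝ (Fin n)) v y)⟩ : TangentBundle (𝓡 k) P)).2) x u =
    fderiv ℝ (fderiv ℝ (extChartAt (𝓡 k) (f x) ∘ f ∘ (extChartAt (𝓡 n) x).symm))
      (extChartAt (𝓡 n) x x)
      (mfderiv (𝓡 n) 𝓘(ℝ, EuclideanSpace ℝ (Fin n)) (extChartAt (𝓡 n) x) x u)
      (mfderiv (𝓡 n) 𝓘(ℝ, EuclideanSpace ℝ (Fin n)) (extChartAt (𝓡 n) x) x v) := by
  set F : EuclideanSpace ℝ (Fin n) → EuclideanSpace ℝ (Fin k) :=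
    extChartAt (𝓡 k) (f x) ∘ f ∘ (extChartAt (𝓡 n) x).symm with hF
  have hFs : ContDiffAt ℝ ∞ F (extChartAt (𝓡 n) x x) := by
    have h := (contMDiffAt_iff.1 (hf x)).2
    rwa [ModelWithCorners.range_eq_univ, contDiffWithinAt_univ] at h
  have hFd : ∀ᶠ y in nhds x, DifferentiableAt ℝ F (extChartAt (𝓡 n) x y) := by
    have h1 : ∀ᶠ z in nhds (extChartAt (𝓡 n) x x), DifferentiableAt ℝ F z := by
      filter_upwards [(hFs.of_le (m := 1) (by simp)).eventually (by simp)] with z hz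
      exact hz.differentiableAt one_ne_zero
    exact (continuousAt_extChartAt (I := 𝓡 n) x).eventually h1
  have hcoord : (fun y ↦ (trivializationAt (EuclideanSpace ℝ (Fin k))
        (TangentSpace (𝓡 k) : P → Type _) (f x) (⟨f y, dmap (n := n) f y
          (FiberBundle.extend (EuclideanSpace ℝ (Fin n)) v y)⟩ : TangentBundle (𝓡 k) P)).2)
      =ᶠ[nhds x] fun y ↦ fderiv ℝ F (extChartAt (𝓡 n) x y)
        (mfderiv (𝓡 n) 𝓘(ℝ, EuclideanSpace ℝ (Fin n)) (extChartAt (𝓡 n) x) x v) := by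
    filter_upwards [hFd, extChartAt_source_mem_nhds (I := 𝓡 n) x,
      hf.continuous.continuousAt.preimage_mem_nhds
        (extChartAt_source_mem_nhds (I := 𝓡 k) (f x))] with y hyd hy hfy
    have hfy' : f y ∈ (chartAt (EuclideanSpace ℝ (Fin k)) (f x)).source := by simpa using hfy
    have hy' : y ∈ (chartAt (EuclideanSpace ℝ (Fin n)) x).source := by simpa using hy
    have hfb : f y ∈ (trivializationAt (EuclideanSpace ℝ (Fin k))
      (TangentSpace (𝓡 k) : P → Type _) (f x)).baseSet := hfy'
    rw [← Trivialization.continuousLinearMapAt_apply_of_mem (R := ℝ) _ hfb,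
      TangentBundle.continuousLinearMapAt_trivializationAt hfy', ← mfderiv_extChartAt_extend hy v]
    have hφ := mdifferentiableAt_extChartAt (I := 𝓡 n) hy'
    have hψ := mdifferentiableAt_extChartAt (I := 𝓡 k) hfy'
    have hfd : MDifferentiableAt (𝓡 n) (𝓡 k) f y := (hf y).mdifferentiableAt (by simp)
    -- Differentiating `F ∘ φ = ψ ∘ f` in two ways identifies the fibre coordinates of `df ∂_v` with
    -- `DF v̂`.
    have heq : F ∘ extChartAt (𝓡 n) x =ᶠ[nhds y] extChartAt (𝓡 k) (f x) ∘ f := by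
      filter_upwards [(isOpen_extChartAt_source (I := 𝓡 n) x).mem_nhds hy] with z hz
      simp only [hF, Function.comp_apply, (extChartAt (𝓡 n) x).left_inv hz]
    have h1 := mfderiv_comp_apply y hψ hfd (FiberBundle.extend (EuclideanSpace ℝ (Fin n)) v y)
    have h2 := mfderiv_comp_apply y hyd.mdifferentiableAt hφ
      (FiberBundle.extend (EuclideanSpace ℝ (Fin n)) v y)
    rw [← mfderiv_eq_fderiv]
    refine h1.symm.trans (Eq.trans ?_ h2)
    rw [heq.mfderiv_eq]
    rfl
  have hF2 : DifferentiableAt ℝ (fderiv ℝ F) (extChartAt (𝓡 n) x x) :=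
    (hFs.fderiv_right (m := 1) (by norm_num; exact ENat.LEInfty.out)).differentiableAt one_ne_zero
  have hG : DifferentiableAt ℝ (fun z ↦ fderiv ℝ F z
      (mfderiv (𝓡 n) 𝓘(ℝ, EuclideanSpace ℝ (Fin n)) (extChartAt (𝓡 n) x) x v))
      (extChartAt (𝓡 n) x x) :=
    hF2.clm_apply (differentiableAt_const _)
  have hφ := mdifferentiableAt_extChartAt (I := 𝓡 n) (mem_chart_source (EuclideanSpace ℝ (Fin n)) x)
  have h3 := mfderiv_comp_apply x hG.mdifferentiableAt hφ u
  have h4 : mvfderiv (𝓡 n) (fun y ↦ (trivializationAt (EuclideanSpace ℝ (Fin k))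
        (TangentSpace (𝓡 k) : P → Type _) (f x) (⟨f y, dmap (n := n) f y
          (FiberBundle.extend (EuclideanSpace ℝ (Fin n)) v y)⟩ : TangentBundle (𝓡 k) P)).2) x u =
      mfderiv (𝓡 n) 𝓘(ℝ, EuclideanSpace ℝ (Fin k)) ((fun z ↦ fderiv ℝ F z
      (mfderiv (𝓡 n) 𝓘(ℝ, EuclideanSpace ℝ (Fin n)) (extChartAt (𝓡 n) x) x v)) ∘
        extChartAt (𝓡 n) x) x u := by
    simp only [mvfderiv, hcoord.mfderiv_eq]
    rfl
  have h5 : ∀ (a b : EuclideanSpace ℝ (Fin n)) (p : EuclideanSpace ℝ (Fin n)),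
      DifferentiableAt ℝ (fderiv ℝ F) p →
      fderiv ℝ (fun z ↦ fderiv ℝ F z b) p a = fderiv ℝ (fderiv ℝ F) p a b := by
    intro a b p hp
    rw [fderiv_clm_apply hp (differentiableAt_const _)]
    simp
  rw [h4, h3, mfderiv_eq_fderiv]
  exact h5 _ _ _ hF2

/-- `∇̄_u (df ∂_v) = ∇̄_v (df ∂_u)` for coordinate fields `∂_u`, `∂_v`. -/
theorem covAlong_dmap_extend_symm {D : LinearConnection k P} (hD : D.torsion = 0)
    (hf : ContMDiff (𝓡 n) (𝓡 k) ∞ f) (x : M) (u v : TangentSpace (𝓡 n) x) :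
    covAlong D f (fun y ↦ dmap (n := n) f y
        (FiberBundle.extend (EuclideanSpace ℝ (Fin n)) v y)) x u =
      covAlong D f (fun y ↦ dmap (n := n) f y
        (FiberBundle.extend (EuclideanSpace ℝ (Fin n)) u y)) x v := by
  have hFs : ContDiffAt ℝ ∞ (extChartAt (𝓡 k) (f x) ∘ f ∘ (extChartAt (𝓡 n) x).symm)
      (extChartAt (𝓡 n) x x) := by
    have h := (contMDiffAt_iff.1 (hf x)).2
    rwa [ModelWithCorners.range_eq_univ, contDiffWithinAt_univ] at h
  -- The two summands of `covAlong` are symmetric separately: the first is a Hessian, the second a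
  -- Christoffel term of a torsion-free connection on `P`.
  have hsymm := hFs.isSymmSndFDerivAt (by simp; exact ENat.LEInfty.out)
  have h1 := mvfderiv_coord_dmap_extend hf x u v
  have h2 := mvfderiv_coord_dmap_extend hf x v u
  have h3 := torsionFree_extend_symm hD (f x) (dmap f x u) (dmap f x v)
  have h4 := h1.trans ((hsymm _ _).trans h2.symm)
  rw [covAlong_apply, covAlong_apply, h4, FiberBundle.extend_apply_self,
    FiberBundle.extend_apply_self]
  exact congrArg _ h3

end Immersion

/-! ### Differentiability tested by inner products. -/

section Duality

variable {n : ℕ} {M : Type*} [TopologicalSpace M] [ChartedSpace (EuclideanSpace ℝ (Fin n)) M]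
  [IsManifold (𝓡 n) ∞ M] [RiemannianBundle (fun x : M ↦ TangentSpace (𝓡 n) x)]
  [IsContMDiffRiemannianBundle (𝓡 n) ∞ (EuclideanSpace ℝ (Fin n))
    (fun x : M ↦ TangentSpace (𝓡 n) x)]

/-- A vector field is differentiable if its inner products with differentiable vector fields
are. -/
theorem mdifferentiableAt_of_inner {Θ : Π x : M, TangentSpace (𝓡 n) x} {x : M}
    (h : ∀ Z : Π x : M, TangentSpace (𝓡 n) x,
      MDifferentiableAt (𝓡 n) (𝓡 n).tangent (fun y ↦ (⟨y, Z y⟩ : TangentBundle (𝓡 n) M)) x →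
      MDifferentiableAt (𝓡 n) 𝓘(ℝ, ℝ) (fun y ↦ inner ℝ (Θ y) (Z y)) x) :
    MDifferentiableAt (𝓡 n) (𝓡 n).tangent (fun y ↦ (⟨y, Θ y⟩ : TangentBundle (𝓡 n) M)) x := by
  classical
  set e := trivializationAt (EuclideanSpace ℝ (Fin n)) (TangentSpace (𝓡 n) : M → Type _) x
  have hp : x ∈ e.baseSet := FiberBundle.mem_baseSet_trivializationAt' x
  let b := (EuclideanSpace.basisFun (Fin n) ℝ).toBasis
  let s : Fin n → Π y : M, TangentSpace (𝓡 n) y := fun i ↦ e.localFrame b i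
  have hs : ∀ i, MDifferentiableAt (𝓡 n) (𝓡 n).tangent
      (fun z ↦ (⟨z, s i z⟩ : TangentBundle (𝓡 n) M)) x := fun i ↦
    (contMDiffAt_localFrame_of_mem (n := 1) e b i hp).mdifferentiableAt one_ne_zero
  -- `A y` is the Gram matrix of the frame `s`, `T i j` being the elementary matrices, and `d y` is
  -- the vector of pairings of `Θ` with the frame. The coordinates of `Θ` are `A⁻¹ d`, and inversion
  -- is smooth at invertible operators.
  let T : Fin n → Fin n → EuclideanSpace ℝ (Fin n) →L[ℝ] EuclideanSpace ℝ (Fin n) := fun i j ↦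
    (EuclideanSpace.proj j : EuclideanSpace ℝ (Fin n) →L[ℝ] ℝ).smulRight (b i)
  let A : M → EuclideanSpace ℝ (Fin n) →L[ℝ] EuclideanSpace ℝ (Fin n) := fun y ↦
    ∑ i, ∑ j, inner ℝ (s j y) (s i y) • T i j
  let d : M → EuclideanSpace ℝ (Fin n) := fun y ↦ ∑ i, inner ℝ (Θ y) (s i y) • b i
  have hA : MDifferentiableAt (𝓡 n) 𝓘(ℝ, EuclideanSpace ℝ (Fin n) →L[ℝ] EuclideanSpace ℝ (Fin n))
      A x := by
    have hA' : A = ∑ i, ∑ j, (fun y ↦ inner ℝ (s j y) (s i y)) • fun _ ↦ T i j := by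
      ext1 y
      simp only [A, Finset.sum_apply]
      rfl
    rw [hA']
    exact MDifferentiableAt.sum fun i _ ↦ MDifferentiableAt.sum fun j _ ↦
      MDifferentiableAt.smul (MDifferentiableAt.inner_bundle (hs j) (hs i)) mdifferentiableAt_const
  have hd : MDifferentiableAt (𝓡 n) 𝓘(ℝ, EuclideanSpace ℝ (Fin n)) d x := by
    have hd' : d = ∑ i, (fun y ↦ inner ℝ (Θ y) (s i y)) • fun _ ↦ b i := by
      ext1 y
      simp only [d, Finset.sum_apply]
      rfl
    rw [hd']
    exact MDifferentiableAt.sum fun i _ ↦ MDifferentiableAt.smul (h _ (hs i)) mdifferentiableAt_const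
  have hAapply : ∀ y w, A y w = ∑ i, inner ℝ (∑ j, w j • s j y) (s i y) • b i := by
    intro y w
    simp only [A, T, sum_apply, smul_apply, ContinuousLinearMap.smulRight_apply, sum_inner,
      real_inner_smul_left, Finset.sum_smul]
    refine Finset.sum_congr rfl fun i _ ↦ Finset.sum_congr rfl fun j _ ↦ ?_
    rw [smul_smul, mul_comm]
    rfl
  have hrepr : ∀ y ∈ e.baseSet, ∀ v : TangentSpace (𝓡 n) y,
      ∑ j, (e (⟨y, v⟩ : TangentBundle (𝓡 n) M)).2 j • s j y = v := by
    intro y hy v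
    conv_rhs => rw [← (e.basisAt b hy).sum_repr v]
    refine Finset.sum_congr rfl fun i _ ↦ ?_
    simp only [s]
    rw [Trivialization.localFrame_apply_of_mem_baseSet e b hy]
    rfl
  -- A vector killed by the Gram matrix gives a combination of the frame orthogonal to every frame
  -- vector, hence to itself, hence zero.
  have hinj : ∀ y ∈ e.baseSet, Function.Injective (A y) := by
    intro y hy
    rw [injective_iff_map_eq_zero]
    intro w hw
    rw [hAapply] at hw
    have h0 : ∀ i, inner ℝ (∑ j, w j • s j y) (s i y) = 0 :=
      Fintype.linearIndependent_iff.1 b.linearIndependent _ hw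
    have h1 : ∑ j, w j • s j y = 0 := by
      rw [← inner_self_eq_zero (𝕜 := ℝ)]
      conv_lhs => rw [inner_sum]
      exact Finset.sum_eq_zero fun i _ ↦ by rw [real_inner_smul_right, h0, mul_zero]
    have h2 : LinearIndependent ℝ fun j ↦ s j y :=
      (e.isLocalFrameOn_localFrame_baseSet (𝓡 n) 1 b).linearIndependent hy
    ext j
    exact Fintype.linearIndependent_iff.1 h2 _ h1 j
  have hinv : ∀ y ∈ e.baseSet, (A y).IsInvertible := fun y hy ↦
    ⟨(LinearEquiv.ofInjectiveEndo (A y : EuclideanSpace ℝ (Fin n) →ₗ[ℝ] _)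
      (hinj y hy)).toContinuousLinearEquiv, by ext; rfl⟩
  refine (mdifferentiableAt_section _ _).2 ?_
  have hcoord : (fun y ↦ (e (⟨y, Θ y⟩ : TangentBundle (𝓡 n) M)).2) =ᶠ[nhds x]
      fun y ↦ (A y).inverse (d y) := by
    filter_upwards [e.open_baseSet.mem_nhds hp] with y hy
    rw [eq_comm, (hinv y hy).inverse_apply_eq, hAapply, hrepr y hy]
  refine MDifferentiableAt.congr_of_eventuallyEq ?_ hcoord
  have hAinv : MDifferentiableAt (𝓡 n)
      𝓘(ℝ, EuclideanSpace ℝ (Fin n) →L[ℝ] EuclideanSpace ℝ (Fin n)) (fun y ↦ (A y).inverse) x :=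
    (((hinv x hp).contDiffAt_map_inverse (n := 1)).differentiableAt
      one_ne_zero).mdifferentiableAt.comp x hA
  exact hAinv.clm_apply hd

end Duality

/-! ### Tangential and normal parts at a point. -/

section Decomposition

variable {n k : ℕ} {M : Type*} [TopologicalSpace M] [ChartedSpace (EuclideanSpace ℝ (Fin n)) M]
  [RiemannianBundle (fun x : M ↦ TangentSpace (𝓡 n) x)]
  {P : Type*} [TopologicalSpace P] [ChartedSpace (EuclideanSpace ℝ (Fin k)) P]
  [RiemannianBundle (fun z : P ↦ TangentSpace (𝓡 k) z)] {f : M → P}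

theorem inner_tangentialPart (f : M → P) (x : M) (W : TangentSpace (𝓡 k) (f x))
    (v : TangentSpace (𝓡 n) x) :
    inner ℝ (tangentialPart f x W) v = inner ℝ W (dmap f x v) :=
  LinearMap.adjoint_inner_left _ _ _

theorem inner_dmap (hf : IsIsometricImmersion n k f) (x : M) (u v : TangentSpace (𝓡 n) x) :
    inner ℝ (dmap (k := k) f x u) (dmap f x v) = inner ℝ u v :=
  hf.isometric x u v

theorem tangentialPart_dmap (hf : IsIsometricImmersion n k f) (x : M)
    (v : TangentSpace (𝓡 n) x) : tangentialPart f x (dmap (k := k) f x v) = v :=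
  ext_inner_right ℝ fun w ↦ by rw [inner_tangentialPart, inner_dmap hf]

theorem tangentialPart_normalPart (hf : IsIsometricImmersion n k f) (x : M)
    (W : TangentSpace (𝓡 k) (f x)) : tangentialPart (n := n) f x (normalPart (n := n) f x W) = 0 := by
  rw [normalPart, map_sub, tangentialPart_dmap hf, sub_self]

/-- Since `η`, `a`, `λ` and `h` are all defined by pairing a normal part with a normal vector, this
removes the projection from each of them. -/
theorem inner_normalPart_of_normal {x : M} {ν : TangentSpace (𝓡 k) (f x)}
    (hν : ∀ u : TangentSpace (𝓡 n) x, inner ℝ (dmap f x u) ν = 0)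
    (W : TangentSpace (𝓡 k) (f x)) : inner ℝ (normalPart (n := n) f x W) ν = inner ℝ W ν := by
  rw [normalPart, inner_sub_left, hν, sub_zero]

end Decomposition

/-! ### The Gauss formula. -/

section Gauss

variable {n k : ℕ} {M : Type*} [TopologicalSpace M] [ChartedSpace (EuclideanSpace ℝ (Fin n)) M]
  [IsManifold (𝓡 n) ∞ M] [RiemannianBundle (fun x : M ↦ TangentSpace (𝓡 n) x)]
  [IsContMDiffRiemannianBundle (𝓡 n) ∞ (EuclideanSpace ℝ (Fin n))
    (fun x : M ↦ TangentSpace (𝓡 n) x)]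
  {P : Type*} [TopologicalSpace P] [ChartedSpace (EuclideanSpace ℝ (Fin k)) P]
  [IsManifold (𝓡 k) ∞ P] [RiemannianBundle (fun z : P ↦ TangentSpace (𝓡 k) z)]
  [IsContMDiffRiemannianBundle (𝓡 k) ∞ (EuclideanSpace ℝ (Fin k))
    (fun z : P ↦ TangentSpace (𝓡 k) z)] {f : M → P}

/-- The tangential part is the adjoint of `df`, so its pairing with `Z` is that of `V` with `df Z`,
which is differentiable. -/
theorem mdifferentiableAt_tangentialPart (hf : IsIsometricImmersion n k f) {x : M}
    {V : Π x : M, TangentSpace (𝓡 k) (f x)} (hV : MDiffAlong n f V x) :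
    MDifferentiableAt (𝓡 n) (𝓡 n).tangent
      (fun y ↦ (⟨y, tangentialPart f y (V y)⟩ : TangentBundle (𝓡 n) M)) x :=
  mdifferentiableAt_of_inner fun Z hZ ↦ by
    simp only [inner_tangentialPart]
    exact hV.inner (mdiffAlong_dmap hf.smooth hZ)

/-- On coordinate fields, the tangential part of the ambient connection is the Levi-Civita
connection of the induced metric. -/
theorem inner_covAlong_dmap_extend {Dbar : LinearConnection k P} (hDbar : IsLeviCivita Dbar)
    {D : LinearConnection n M} (hD : IsLeviCivita D) (hf : IsIsometricImmersion n k f) (x : M)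
    (u v w : TangentSpace (𝓡 n) x) :
    inner ℝ (covAlong Dbar f (fun y ↦ dmap (n := n) f y
        (FiberBundle.extend (EuclideanSpace ℝ (Fin n)) v y)) x u) (dmap f x w) =
      inner ℝ (D (FiberBundle.extend (EuclideanSpace ℝ (Fin n)) v) x u) w := by
  -- The defect `t` is symmetric in its first two arguments, as both connections are torsion-free,
  -- and skew in its last two, as both are metric. These two symmetries force it to vanish.
  let t : TangentSpace (𝓡 n) x → TangentSpace (𝓡 n) x → TangentSpace (𝓡 n) x → ℝ := fun u v w ↦
    inner ℝ (covAlong Dbar f (fun y ↦ dmap (n := n) f y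
        (FiberBundle.extend (EuclideanSpace ℝ (Fin n)) v y)) x u) (dmap f x w) -
      inner ℝ (D (FiberBundle.extend (EuclideanSpace ℝ (Fin n)) v) x u) w
  have hsymm : ∀ u v w, t u v w = t v u w := by
    intro u v w
    simp only [t]
    rw [covAlong_dmap_extend_symm hDbar.torsion_eq_zero hf.smooth x u v,
      torsionFree_extend_symm hD.torsion_eq_zero x u v]
  have hskew : ∀ u v w, t u v w = -t u w v := by
    intro u v w
    have hv := FiberBundle.mdifferentiableAt_extend (𝓡 n) (EuclideanSpace ℝ (Fin n)) v
    have hw := FiberBundle.mdifferentiableAt_extend (𝓡 n) (EuclideanSpace ℝ (Fin n)) w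
    have h1 := mvfderiv_inner_along hDbar.metric (mdiffAlong_dmap hf.smooth hv)
      (mdiffAlong_dmap hf.smooth hw) u
    classical
    have h2 := hD.metric.mvfderiv_inner_eq (Function.update (fun _ ↦ 0) x u) hv hw
    -- By isometry, `g(df ∂_v, df ∂_w)` and `g(∂_v, ∂_w)` are the same function, so the two product
    -- rules can be compared.
    simp only [inner_dmap hf] at h1
    simp only [Function.update_self] at h2
    rw [h2] at h1
    simp only [FiberBundle.extend_apply_self] at h1
    simp only [t]
    have h3 : inner ℝ v (D (FiberBundle.extend (EuclideanSpace ℝ (Fin n)) w) x u) =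
        inner ℝ (D (FiberBundle.extend (EuclideanSpace ℝ (Fin n)) w) x u) v := real_inner_comm _ _
    have h4 : inner ℝ (dmap f x v) (covAlong Dbar f (fun y ↦ dmap (n := n) f y
          (FiberBundle.extend (EuclideanSpace ℝ (Fin n)) w y)) x u) =
        inner ℝ (covAlong Dbar f (fun y ↦ dmap (n := n) f y
          (FiberBundle.extend (EuclideanSpace ℝ (Fin n)) w y)) x u) (dmap f x v) :=
      real_inner_comm _ _
    linarith
  -- Alternating the two symmetries: `t u v w = -t u w v = -t w u v = t w v u = t v w u = -t v u w =
  -- -t u v w`.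
  have h : t u v w = 0 := by
    have h1 := hskew u v w
    have h2 := hsymm u w v
    have h3 := hskew w u v
    have h4 := hsymm w v u
    have h5 := hskew v w u
    have h6 := hsymm v u w
    linarith
  exact sub_eq_zero.1 h

/-- **Gauss formula**. -/
theorem covAlong_dmap {Dbar : LinearConnection k P} (hDbar : IsLeviCivita Dbar)
    {D : LinearConnection n M} (hD : IsLeviCivita D) (hf : IsIsometricImmersion n k f) {x : M}
    {Y : Π x : M, TangentSpace (𝓡 n) x}
    (hY : MDifferentiableAt (𝓡 n) (𝓡 n).tangent (fun y ↦ (⟨y, Y y⟩ : TangentBundle (𝓡 n) M)) x)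
    (u : TangentSpace (𝓡 n) x) :
    covAlong Dbar f (fun y ↦ dmap (n := n) f y (Y y)) x u =
      dmap f x (D Y x u) + secondForm Dbar f x u (Y x) := by
  have hcov : IsCovariantDerivativeOn (EuclideanSpace ℝ (Fin n)) D.toFun Set.univ :=
    D.isCovariantDerivativeOn
  -- The derivative terms in the two Leibniz rules cancel, so `∇̄_u (df Y) - df (∇_u Y)` depends
  -- only on `Y x` and may be computed on the coordinate field `extend (Y x)`, where it is the
  -- second fundamental form by definition.
  have htens : TensorialAt (𝓡 n) (EuclideanSpace ℝ (Fin n))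
      (fun Y : Π x : M, TangentSpace (𝓡 n) x ↦
        covAlong Dbar f (fun y ↦ dmap (n := n) f y (Y y)) x u - dmap f x (D Y x u)) x := by
    constructor
    · intro g Z hg hZ
      have h1 := covAlong_smul_apply Dbar hg (mdiffAlong_dmap hf.smooth hZ) u
      have h2 : D (g • Z) x u = g x • D Z x u + mvfderiv (𝓡 n) g x u • Z x := by
        rw [show D (g • Z) x = _ from hcov.leibniz hZ hg]
        rfl
      simp only [Pi.smul_apply', map_smul]
      rw [h1, h2, map_add, map_smul, map_smul, smul_sub]
      abel
    · intro Z Z' hZ hZ'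
      have h1 := covAlong_add_apply Dbar (mdiffAlong_dmap hf.smooth hZ)
        (mdiffAlong_dmap hf.smooth hZ') u
      have h2 : D (Z + Z') x u = D Z x u + D Z' x u := by
        rw [show D (Z + Z') x = _ from hcov.add hZ hZ']
        rfl
      simp only [Pi.add_apply, map_add]
      rw [h1, h2, map_add]
      abel
  have hE := FiberBundle.mdifferentiableAt_extend (𝓡 n) (EuclideanSpace ℝ (Fin n)) (Y x)
  have h := htens.pointwise hY hE (FiberBundle.extend_apply_self _ _).symm
  have htan : tangentialPart f x (covAlong Dbar f (fun y ↦ dmap (n := n) f y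
      (FiberBundle.extend (EuclideanSpace ℝ (Fin n)) (Y x) y)) x u) =
      D (FiberBundle.extend (EuclideanSpace ℝ (Fin n)) (Y x)) x u :=
    ext_inner_right ℝ fun w ↦ by
      rw [inner_tangentialPart, inner_covAlong_dmap_extend hDbar hD hf]
  rw [secondForm, normalPart, htan, ← h]
  abel

end Gauss

/-! ### Components in an orthonormal normal frame. -/

section NormalFrame

variable {n r : ℕ} {M : Type*} [TopologicalSpace M] [ChartedSpace (EuclideanSpace ℝ (Fin n)) M]
  [RiemannianBundle (fun x : M ↦ TangentSpace (𝓡 n) x)]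
  {P : Type*} [TopologicalSpace P] [ChartedSpace (EuclideanSpace ℝ (Fin (n + r))) P]
  [IsManifold (𝓡 (n + r)) ∞ P] [RiemannianBundle (fun z : P ↦ TangentSpace (𝓡 (n + r)) z)]
  {f : M → P} {U : Set M} {N : Fin r → Π x : M, TangentSpace (𝓡 (n + r)) (f x)} {x : M}

/-- A normal vector is a combination of the vectors of a normal frame. -/
theorem IsNormalFrame.eq_sum_of_normal (hN : IsNormalFrame n f U N)
    (hf : IsIsometricImmersion n (n + r) f) (hx : x ∈ U) {W : TangentSpace (𝓡 (n + r)) (f x)}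
    (hW : ∀ v : TangentSpace (𝓡 n) x, inner ℝ (dmap f x v) W = 0) :
    W = ∑ α, (inner ℝ W (N α x) : ℝ) • N α x := by
  let K : Submodule ℝ (TangentSpace (𝓡 (n + r)) (f x)) := LinearMap.range (dmap (n := n) f x)
  have hmem : ∀ ν : TangentSpace (𝓡 (n + r)) (f x),
      (∀ v : TangentSpace (𝓡 n) x, inner ℝ (dmap f x v) ν = 0) → ν ∈ Kᗮ := by
    intro ν hν
    rw [Submodule.mem_orthogonal]
    rintro _ ⟨v, rfl⟩
    exact hν v
  have hinj : Function.Injective (dmap (n := n) (k := n + r) f x) :=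
    Function.LeftInverse.injective (tangentialPart_dmap hf x)
  have hK : Module.finrank ℝ K = n :=
    (LinearMap.finrank_range_of_inj hinj).trans finrank_euclideanSpace_fin
  have hP : Module.finrank ℝ (TangentSpace (𝓡 (n + r)) (f x)) = n + r :=
    finrank_euclideanSpace_fin
  -- Here the codimension enters: the normal space has dimension exactly `r`, so `r` orthonormal
  -- normal vectors span it.
  have hKo : Module.finrank ℝ Kᗮ = r := by
    have h := K.finrank_add_finrank_orthogonal
    omega
  let ν : Fin r → Kᗮ := fun α ↦ ⟨N α x, hmem _ fun v ↦ hN.normal x hx α v⟩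
  have hν : Orthonormal ℝ ν := by
    have h := hN.orthonormal x hx
    rw [orthonormal_iff_ite] at h ⊢
    exact h
  -- With `s = univ`, the extending basis coincides with the frame itself.
  obtain ⟨b, hb⟩ := Orthonormal.exists_orthonormalBasis_extension_of_card_eq (𝕜 := ℝ)
    (by rw [hKo, Fintype.card_fin]) (v := ν) (s := Set.univ)
    (hν.comp _ Subtype.val_injective)
  have h := congrArg Subtype.val (b.sum_repr' ⟨W, hmem W hW⟩)
  simp only [hb _ (Set.mem_univ _), Submodule.coe_sum, Submodule.coe_smul] at h
  refine h.symm.trans (Finset.sum_congr rfl fun α _ ↦ ?_)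
  congr 1
  exact real_inner_comm _ _

omit [RiemannianBundle (fun x : M ↦ TangentSpace (𝓡 n) x)] in
theorem IsNormalFrame.inner_dmap (hN : IsNormalFrame n f U N) (hx : x ∈ U) (α : Fin r)
    (u : TangentSpace (𝓡 n) x) : inner ℝ (N α x) (dmap f x u) = 0 :=
  (real_inner_comm _ _).trans (hN.normal x hx α u)

theorem IsNormalFrame.inner_normalPart (hN : IsNormalFrame n f U N) (hx : x ∈ U) (α : Fin r)
    (W : TangentSpace (𝓡 (n + r)) (f x)) :
    inner ℝ (normalPart (n := n) f x W) (N α x) = inner ℝ W (N α x) :=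
  inner_normalPart_of_normal (hN.normal x hx α) W

/-- The decomposition of an ambient vector into its tangential part and its components in a
normal frame. -/
theorem IsNormalFrame.eq_dmap_add_sum (hN : IsNormalFrame n f U N)
    (hf : IsIsometricImmersion n (n + r) f) (hx : x ∈ U) (W : TangentSpace (𝓡 (n + r)) (f x)) :
    W = dmap (n := n) f x (tangentialPart f x W) + ∑ α, (inner ℝ W (N α x) : ℝ) • N α x := by
  have h := hN.eq_sum_of_normal hf hx (W := normalPart (n := n) f x W) fun v ↦
    (real_inner_comm _ _).trans (MetallicSubmanifold.inner_normalPart hf x W v)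
  simp only [hN.inner_normalPart hx] at h
  rw [← h, normalPart]
  abel

theorem IsNormalFrame.tangentialPart_eq_zero (hN : IsNormalFrame n f U N) (hx : x ∈ U)
    (α : Fin r) : tangentialPart (n := n) f x (N α x) = 0 :=
  ext_inner_right ℝ fun w ↦ by rw [inner_tangentialPart, hN.inner_dmap hx, inner_zero_left]

theorem IsNormalFrame.indEta_eq (hN : IsNormalFrame n f U N) (hx : x ∈ U)
    (J : Π z : P, TangentSpace (𝓡 (n + r)) z →L[ℝ] TangentSpace (𝓡 (n + r)) z) (α : Fin r)
    (u : TangentSpace (𝓡 n) x) :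
    indEta J f (N α) x u = inner ℝ (J (f x) (dmap f x u)) (N α x) :=
  hN.inner_normalPart hx α _

theorem IsNormalFrame.indA_eq (hN : IsNormalFrame n f U N) (hx : x ∈ U)
    (J : Π z : P, TangentSpace (𝓡 (n + r)) z →L[ℝ] TangentSpace (𝓡 (n + r)) z) (α β : Fin r) :
    indA n J f (N α) (N β) x = inner ℝ (J (f x) (N α x)) (N β x) :=
  hN.inner_normalPart hx β _

theorem IsNormalFrame.normalForm_eq (hN : IsNormalFrame n f U N) (hx : x ∈ U)
    (D : LinearConnection (n + r) P) (α β : Fin r) (u : TangentSpace (𝓡 n) x) :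
    normalForm D f (N α) (N β) x u = inner ℝ (covAlong D f (N α) x u) (N β x) :=
  hN.inner_normalPart hx β _

omit [RiemannianBundle (fun x : M ↦ TangentSpace (𝓡 n) x)] in
theorem IsNormalFrame.mdiffAlong (hN : IsNormalFrame n f U N) (hU : IsOpen U) (hx : x ∈ U)
    (α : Fin r) : MDiffAlong n f (N α) x :=
  ((hN.smooth α).contMDiffAt (hU.mem_nhds hx)).mdifferentiableAt (by simp)

end NormalFrame

/-! ### The Weingarten formula and derivatives of components. -/

section Weingarten

variable {n r : ℕ} {M : Type*} [TopologicalSpace M] [ChartedSpace (EuclideanSpace ℝ (Fin n)) M]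
  [IsManifold (𝓡 n) ∞ M] [RiemannianBundle (fun x : M ↦ TangentSpace (𝓡 n) x)]
  [IsContMDiffRiemannianBundle (𝓡 n) ∞ (EuclideanSpace ℝ (Fin n))
    (fun x : M ↦ TangentSpace (𝓡 n) x)]
  {P : Type*} [TopologicalSpace P] [ChartedSpace (EuclideanSpace ℝ (Fin (n + r))) P]
  [IsManifold (𝓡 (n + r)) ∞ P] [RiemannianBundle (fun z : P ↦ TangentSpace (𝓡 (n + r)) z)]
  [IsContMDiffRiemannianBundle (𝓡 (n + r)) ∞ (EuclideanSpace ℝ (Fin (n + r)))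
    (fun z : P ↦ TangentSpace (𝓡 (n + r)) z)]
  {f : M → P} {U : Set M} {N : Fin r → Π x : M, TangentSpace (𝓡 (n + r)) (f x)} {x : M}
  {Dbar : LinearConnection (n + r) P}

omit [IsManifold (𝓡 n) ∞ M] [IsContMDiffRiemannianBundle (𝓡 n) ∞ (EuclideanSpace ℝ (Fin n))
  (fun x : M ↦ TangentSpace (𝓡 n) x)] in
/-- The connection forms of an orthonormal normal frame are skew-symmetric. -/
theorem IsNormalFrame.normalForm_skew (hN : IsNormalFrame n f U N) (hU : IsOpen U) (hx : x ∈ U)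
    (hD : IsLeviCivita Dbar) (α β : Fin r) (u : TangentSpace (𝓡 n) x) :
    normalForm Dbar f (N α) (N β) x u = -normalForm Dbar f (N β) (N α) x u := by
  have h := mvfderiv_inner_along hD.metric (hN.mdiffAlong hU hx α) (hN.mdiffAlong hU hx β) u
  have h0 : (fun y ↦ inner ℝ (N α y) (N β y)) =ᶠ[nhds x]
      fun _ ↦ (if α = β then (1 : ℝ) else 0) := by
    filter_upwards [hU.mem_nhds hx] with y hy
    exact orthonormal_iff_ite.1 (hN.orthonormal y hy) α β
  rw [mvfderiv_apply_congr h0, mvfderiv_const, zero_apply] at h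
  rw [hN.normalForm_eq hx, hN.normalForm_eq hx]
  have h1 : inner ℝ (N α x) (covAlong Dbar f (N β) x u) =
      inner ℝ (covAlong Dbar f (N β) x u) (N α x) := real_inner_comm _ _
  linarith

omit [IsContMDiffRiemannianBundle (𝓡 n) ∞ (EuclideanSpace ℝ (Fin n))
  (fun x : M ↦ TangentSpace (𝓡 n) x)] in
/-- **Weingarten formula**. -/
theorem IsNormalFrame.covAlong_eq (hN : IsNormalFrame n f U N) (hU : IsOpen U) (hx : x ∈ U)
    (hDbar : IsLeviCivita Dbar) (hf : IsIsometricImmersion n (n + r) f) (α : Fin r)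
    (u : TangentSpace (𝓡 n) x) :
    covAlong Dbar f (N α) x u = -dmap f x (shapeOp Dbar f x (N α x) u) +
      ∑ β, normalForm Dbar f (N α) (N β) x u • N β x := by
  -- Differentiate `g(N_α, df ∂_v) = 0`, which holds near `x` because `U` is open.
  have htan : tangentialPart f x (covAlong Dbar f (N α) x u) = -shapeOp Dbar f x (N α x) u := by
    refine ext_inner_right ℝ fun v ↦ ?_
    have hE := FiberBundle.mdifferentiableAt_extend (𝓡 n) (EuclideanSpace ℝ (Fin n)) v
    have h := mvfderiv_inner_along hDbar.metric (hN.mdiffAlong hU hx α)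
      (mdiffAlong_dmap hf.smooth hE) u
    have h0 : (fun y ↦ inner ℝ (N α y) (dmap (n := n) f y
        (FiberBundle.extend (EuclideanSpace ℝ (Fin n)) v y))) =ᶠ[nhds x] fun _ ↦ (0 : ℝ) := by
      filter_upwards [hU.mem_nhds hx] with y hy
      exact hN.inner_dmap hy α _
    rw [mvfderiv_apply_congr h0, mvfderiv_const, zero_apply, FiberBundle.extend_apply_self] at h
    rw [inner_tangentialPart, inner_neg_left, inner_shapeOp Dbar hf.smooth, secondFormAt,
      secondForm, hN.inner_normalPart hx]
    have h1 := real_inner_comm (N α x) (covAlong Dbar f (fun y ↦ dmap (n := n) f y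
      (FiberBundle.extend (EuclideanSpace ℝ (Fin n)) v y)) x u)
    linarith
  have h := hN.eq_dmap_add_sum hf hx (covAlong Dbar f (N α) x u)
  rw [htan, map_neg] at h
  simpa only [← hN.normalForm_eq hx] using h

omit [IsContMDiffRiemannianBundle (𝓡 n) ∞ (EuclideanSpace ℝ (Fin n))
  (fun x : M ↦ TangentSpace (𝓡 n) x)]
  [IsContMDiffRiemannianBundle (𝓡 (n + r)) ∞ (EuclideanSpace ℝ (Fin (n + r)))
  (fun z : P ↦ TangentSpace (𝓡 (n + r)) z)] in
theorem IsNormalFrame.secondForm_eq (hN : IsNormalFrame n f U N) (hx : x ∈ U)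
    (hf : IsIsometricImmersion n (n + r) f) (u v : TangentSpace (𝓡 n) x) :
    secondForm Dbar f x u v = ∑ α, secondFormAt Dbar f x (N α x) u v • N α x :=
  hN.eq_sum_of_normal hf hx fun w ↦
    (real_inner_comm _ _).trans (MetallicSubmanifold.inner_normalPart hf x _ w)

/-- The derivative of the normal components of a vector field along `f`. -/
theorem IsNormalFrame.mvfderiv_inner (hN : IsNormalFrame n f U N) (hU : IsOpen U) (hx : x ∈ U)
    (hDbar : IsLeviCivita Dbar) (hf : IsIsometricImmersion n (n + r) f)
    {V : Π x : M, TangentSpace (𝓡 (n + r)) (f x)} (hV : MDiffAlong n f V x) (α : Fin r)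
    (u : TangentSpace (𝓡 n) x) :
    mvfderiv (𝓡 n) (fun y ↦ inner ℝ (V y) (N α y)) x u =
      inner ℝ (covAlong Dbar f V x u) (N α x) -
        secondFormAt Dbar f x (N α x) u (tangentialPart f x (V x)) +
        ∑ β, inner ℝ (V x) (N β x) * normalForm Dbar f (N α) (N β) x u := by
  -- In the term `g(V, ∇̄_u N_α)`, the Weingarten formula contributes `-g(V, df A_α u) = -g(Vᵀ, A_α
  -- u) = -h_α(u, Vᵀ)`.
  rw [mvfderiv_inner_along hDbar.metric hV (hN.mdiffAlong hU hx α),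
    hN.covAlong_eq hU hx hDbar hf α u, inner_add_right, inner_neg_right, ← inner_tangentialPart,
    inner_sum, ← inner_shapeOp Dbar hf.smooth]
  simp only [real_inner_smul_right]
  have h1 := real_inner_comm (tangentialPart (n := n) f x (V x)) (shapeOp Dbar f x (N α x) u)
  have h2 : ∑ β, normalForm Dbar f (N α) (N β) x u * inner ℝ (V x) (N β x) =
      ∑ β, inner ℝ (V x) (N β x) * normalForm Dbar f (N α) (N β) x u :=
    Finset.sum_congr rfl fun β _ ↦ mul_comm _ _
  linarith

/-- The derivative of the tangential part of a vector field along `f`. -/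
theorem IsNormalFrame.tangentialPart_covAlong (hN : IsNormalFrame n f U N) (hU : IsOpen U)
    (hx : x ∈ U) (hDbar : IsLeviCivita Dbar) {D : LinearConnection n M} (hD : IsLeviCivita D)
    (hf : IsIsometricImmersion n (n + r) f) {V : Π x : M, TangentSpace (𝓡 (n + r)) (f x)}
    (hV : MDiffAlong n f V x) (u : TangentSpace (𝓡 n) x) :
    tangentialPart f x (covAlong Dbar f V x u) =
      D (fun y ↦ tangentialPart f y (V y)) x u -
        ∑ α, (inner ℝ (V x) (N α x) : ℝ) • shapeOp Dbar f x (N α x) u := by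
  have hfx := hV.mdifferentiableAt_base
  have hT := mdifferentiableAt_tangentialPart hf hV
  have hTd := mdiffAlong_dmap hf.smooth hT
  have hc : ∀ α, MDifferentiableAt (𝓡 n) 𝓘(ℝ, ℝ) (fun y ↦ (inner ℝ (V y) (N α y) : ℝ)) x :=
    fun α ↦ hV.inner (hN.mdiffAlong hU hx α)
  have hterm : ∀ α, MDiffAlong n f (fun y ↦ (inner ℝ (V y) (N α y) : ℝ) • N α y) x := fun α ↦
    (hN.mdiffAlong hU hx α).smul (hc α)
  -- Differentiate `V = df Vᵀ + ∑ g(V, N_α) N_α` and project. By Gauss the first term leaves `∇_u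
  -- Vᵀ`.
  have hdec : ∀ᶠ y in nhds x, V y = dmap (n := n) f y (tangentialPart f y (V y)) +
      ∑ α, (inner ℝ (V y) (N α y) : ℝ) • N α y := by
    filter_upwards [hU.mem_nhds hx] with y hy
    exact hN.eq_dmap_add_sum hf hy (V y)
  have hsum : covAlong Dbar f (fun y ↦ ∑ α, (inner ℝ (V y) (N α y) : ℝ) • N α y) x u =
      ∑ α, covAlong Dbar f (fun y ↦ (inner ℝ (V y) (N α y) : ℝ) • N α y) x u := by
    rw [covAlong_sum Dbar hfx fun α _ ↦ hterm α, sum_apply]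
  rw [covAlong_congr Dbar hdec, covAlong_add_apply Dbar hTd (MDiffAlong.sum hfx fun α _ ↦ hterm α),
    hsum, covAlong_dmap hDbar hD hf hT, map_add, map_add, tangentialPart_dmap hf, map_sum,
    secondForm, tangentialPart_normalPart hf, add_zero, sub_eq_add_neg, ← Finset.sum_neg_distrib]
  congr 1
  -- The derivative of the coefficient multiplies `N_α` and is lost in the projection, as are the
  -- `λ` terms; only `-A_α u` survives.
  refine Finset.sum_congr rfl fun α _ ↦ ?_
  rw [covAlong_smul_apply Dbar (hc α) (hN.mdiffAlong hU hx α), hN.covAlong_eq hU hx hDbar hf,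
    map_add, map_smul, map_smul, map_add, map_neg, tangentialPart_dmap hf, map_sum]
  simp only [map_smul, hN.tangentialPart_eq_zero hx, smul_zero, Finset.sum_const_zero, add_zero,
    smul_neg]

end Weingarten

end MetallicSubmanifold

/-! ### The structure equations of the induced structure. -/

open MetallicSubmanifold
theorem mainTheorem3 {n r : ℕ}
    {M : Type*} [TopologicalSpace M] [ChartedSpace (EuclideanSpace ℝ (Fin n)) M]
    [IsManifold (𝓡 n) ∞ M]
    [RiemannianBundle (fun x : M ↦ TangentSpace (𝓡 n) x)]
    [IsContMDiffRiemannianBundle (𝓡 n) ∞ (EuclideanSpace ℝ (Fin n))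
      (fun x : M ↦ TangentSpace (𝓡 n) x)]
    {P : Type*} [TopologicalSpace P] [ChartedSpace (EuclideanSpace ℝ (Fin (n + r))) P]
    [IsManifold (𝓡 (n + r)) ∞ P]
    [RiemannianBundle (fun z : P ↦ TangentSpace (𝓡 (n + r)) z)]
    [IsContMDiffRiemannianBundle (𝓡 (n + r)) ∞ (EuclideanSpace ℝ (Fin (n + r)))
      (fun z : P ↦ TangentSpace (𝓡 (n + r)) z)]
    (p q : ℕ) (J : Π z : P, TangentSpace (𝓡 (n + r)) z →L[ℝ] TangentSpace (𝓡 (n + r)) z)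
    (Dbar : LinearConnection (n + r) P) (hJ : IsLocallyMetallic p q J Dbar)
    (D : LinearConnection n M) (hD : IsLeviCivita D)
    (f : M → P) (hf : IsIsometricImmersion n (n + r) f)
    (U : Set M) (hU : IsOpen U)
    (N : Fin r → Π x : M, TangentSpace (𝓡 (n + r)) (f x)) (hN : IsNormalFrame n f U N)
    (X Y : Π x : M, TangentSpace (𝓡 n) x)
    (hX : ContMDiffOn (𝓡 n) (𝓡 n).tangent ∞ (fun x ↦ (⟨x, X x⟩ : TangentBundle (𝓡 n) M)) U)
    (hY : ContMDiffOn (𝓡 n) (𝓡 n).tangent ∞ (fun x ↦ (⟨x, Y x⟩ : TangentBundle (𝓡 n) M)) U)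
    (x : M) (hx : x ∈ U) :
    -- the induced fields are differentiable, so that the derivatives below are meaningful
    (MDifferentiableAt (𝓡 n) (𝓡 n).tangent
        (fun y ↦ (⟨y, indT J f y (Y y)⟩ : TangentBundle (𝓡 n) M)) x ∧
      (∀ α, MDifferentiableAt (𝓡 n) 𝓘(ℝ, ℝ) (fun y ↦ indEta J f (N α) y (Y y)) x) ∧
      (∀ α, MDifferentiableAt (𝓡 n) (𝓡 n).tangent
        (fun y ↦ (⟨y, indXi J f (N α) y⟩ : TangentBundle (𝓡 n) M)) x) ∧
      ∀ α β, MDifferentiableAt (𝓡 n) 𝓘(ℝ, ℝ) (indA n J f (N α) (N β)) x) ∧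
    -- the covariant derivative of `T`
    covDerivEndo D (indT J f) Y x (X x) =
      ∑ α, (indEta J f (N α) x (Y x) • shapeOp Dbar f x (N α x) (X x) +
        secondFormAt Dbar f x (N α x) (X x) (Y x) • indXi J f (N α) x) ∧
    -- the covariant derivative of `η_α`
    (∀ α, covDerivForm D (indEta J f (N α)) Y x (X x) =
      -secondFormAt Dbar f x (N α x) (X x) (indT J f x (Y x)) +
        ∑ β, (indA n J f (N α) (N β) x * secondFormAt Dbar f x (N β x) (X x) (Y x) +
          indEta J f (N β) x (Y x) * normalForm Dbar f (N α) (N β) x (X x))) ∧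
    -- the covariant derivative of `ξ_α`
    (∀ α, D (indXi J f (N α)) x (X x) =
      -indT J f x (shapeOp Dbar f x (N α x) (X x)) +
        ∑ β, (indA n J f (N α) (N β) x • shapeOp Dbar f x (N β x) (X x) +
          normalForm Dbar f (N α) (N β) x (X x) • indXi J f (N β) x)) ∧
    -- the derivative of `a_{αβ}`
    (∀ α β, mvfderiv (𝓡 n) (indA n J f (N α) (N β)) x (X x) =
      -(secondFormAt Dbar f x (N α x) (X x) (indXi J f (N β) x) +
          secondFormAt Dbar f x (N β x) (X x) (indXi J f (N α) x)) -
        ∑ γ, (indA n J f (N α) (N γ) x * normalForm Dbar f (N γ) (N β) x (X x) +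
          indA n J f (N β) (N γ) x * normalForm Dbar f (N γ) (N α) x (X x))) := by
  have hDbar := hJ.leviCivita
  have hsym := hJ.metallic.symm
  have hYx : MDifferentiableAt (𝓡 n) (𝓡 n).tangent
      (fun y ↦ (⟨y, Y y⟩ : TangentBundle (𝓡 n) M)) x :=
    (hY.contMDiffAt (hU.mem_nhds hx)).mdifferentiableAt (by simp)
  have hdY := mdiffAlong_dmap hf.smooth hYx
  have hJdY := fun u ↦ covAlong_endo Dbar hJ.metallic.smooth hJ.parallel hdY u
  have hNx := hN.mdiffAlong hU hx
  have hJN := fun α u ↦ covAlong_endo Dbar hJ.metallic.smooth hJ.parallel (hNx α) u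
  -- Equality of germs, not just of values at `x`, is needed to differentiate `η_α(Y)` and `a_{αβ}`.
  have hη : ∀ α, (fun y ↦ indEta J f (N α) y (Y y)) =ᶠ[nhds x]
      fun y ↦ inner ℝ (J (f y) (dmap f y (Y y))) (N α y) := fun α ↦ by
    filter_upwards [hU.mem_nhds hx] with y hy
    exact hN.indEta_eq hy J α _
  have ha : ∀ α β, (indA n J f (N α) (N β)) =ᶠ[nhds x]
      fun y ↦ inner ℝ (J (f y) (N α y)) (N β y) := fun α β ↦ by
    filter_upwards [hU.mem_nhds hx] with y hy
    exact hN.indA_eq hy J α β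
  have haS : ∀ α β, indA n J f (N α) (N β) x = indA n J f (N β) (N α) x := fun α β ↦ by
    rw [hN.indA_eq hx, hN.indA_eq hx, hsym]
    exact real_inner_comm _ _
  -- Duality of `η_α` and `ξ_α` will turn `η_β(A_α u)` into `h_α(u, ξ_β)`.
  have hηξ : ∀ α u, indEta J f (N α) x u = inner ℝ u (indXi J f (N α) x) := fun α u ↦ by
    rw [hN.indEta_eq hx, hsym, real_inner_comm, ← inner_tangentialPart]
    exact real_inner_comm _ _
  -- `J` applied to the Gauss and Weingarten formulas
  have hG : J (f x) (covAlong Dbar f (fun y ↦ dmap (n := n) f y (Y y)) x (X x)) =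
      J (f x) (dmap f x (D Y x (X x))) +
        ∑ α, secondFormAt Dbar f x (N α x) (X x) (Y x) • J (f x) (N α x) := by
    rw [covAlong_dmap hDbar hD hf hYx, hN.secondForm_eq hx hf, map_add, map_sum]
    simp only [map_smul]
  have hW : ∀ α, J (f x) (covAlong Dbar f (N α) x (X x)) =
      -J (f x) (dmap f x (shapeOp Dbar f x (N α x) (X x))) +
        ∑ β, normalForm Dbar f (N α) (N β) x (X x) • J (f x) (N β x) := fun α ↦ by
    rw [hN.covAlong_eq hU hx hDbar hf, map_add, map_neg, map_sum]
    simp only [map_smul]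
  refine ⟨⟨mdifferentiableAt_tangentialPart hf (hJdY (X x)).1, fun α ↦ ?_,
    fun α ↦ mdifferentiableAt_tangentialPart hf (hJN α (X x)).1, fun α β ↦ ?_⟩, ?_, fun α ↦ ?_,
    fun α ↦ ?_, fun α β ↦ ?_⟩
  · exact ((hJdY (X x)).1.inner (hNx α)).congr_of_eventuallyEq (hη α)
  · exact ((hJN α (X x)).1.inner (hNx β)).congr_of_eventuallyEq (ha α β)
  · have h := hN.tangentialPart_covAlong hU hx hDbar hD hf (hJdY (X x)).1 (X x)
    rw [(hJdY (X x)).2, hG, map_add, map_sum] at h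
    simp only [map_smul, ← hN.indEta_eq hx] at h
    rw [Finset.sum_add_distrib, covDerivEndo, sub_eq_iff_eq_add]
    have h' := eq_add_of_sub_eq h.symm
    refine h'.trans ?_
    simp only [indT, indXi]
    abel
  · have h := hN.mvfderiv_inner hU hx hDbar hf (hJdY (X x)).1 α (X x)
    rw [← mvfderiv_apply_congr (hη α), (hJdY (X x)).2, hG, inner_add_left, sum_inner] at h
    simp only [real_inner_smul_left, ← hN.indEta_eq hx, ← hN.indA_eq hx] at h
    rw [covDerivForm, h, Finset.sum_add_distrib]
    simp only [indT, haS α, mul_comm (secondFormAt _ _ _ _ _ _)]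
    ring
  · have h := hN.tangentialPart_covAlong hU hx hDbar hD hf (hJN α (X x)).1 (X x)
    rw [(hJN α (X x)).2, hW, map_add, map_neg, map_sum] at h
    simp only [map_smul, ← hN.indA_eq hx] at h
    rw [Finset.sum_add_distrib]
    have h' := eq_add_of_sub_eq h.symm
    refine h'.trans ?_
    simp only [indT, indXi]
    abel
  · have h := hN.mvfderiv_inner hU hx hDbar hf (hJN α (X x)).1 β (X x)
    rw [← mvfderiv_apply_congr (ha α β), (hJN α (X x)).2, hW, inner_add_left, inner_neg_left,
      sum_inner] at h
    simp only [real_inner_smul_left, ← hN.indEta_eq hx, ← hN.indA_eq hx] at h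
    rw [hηξ, inner_shapeOp Dbar hf.smooth] at h
    -- Skewness of `λ`, with symmetry of `a` in the first sum, puts both sums into the stated index
    -- order and accounts for their minus sign.
    have h1 : ∑ γ, normalForm Dbar f (N α) (N γ) x (X x) * indA n J f (N γ) (N β) x =
        -∑ γ, indA n J f (N β) (N γ) x * normalForm Dbar f (N γ) (N α) x (X x) := by
      rw [← Finset.sum_neg_distrib]
      refine Finset.sum_congr rfl fun γ _ ↦ ?_
      rw [hN.normalForm_skew hU hx hDbar α γ, haS γ β]
      ring
    have h2 : ∑ γ, indA n J f (N α) (N γ) x * normalForm Dbar f (N β) (N γ) x (X x) =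
        -∑ γ, indA n J f (N α) (N γ) x * normalForm Dbar f (N γ) (N β) x (X x) := by
      rw [← Finset.sum_neg_distrib]
      refine Finset.sum_congr rfl fun γ _ ↦ ?_
      rw [hN.normalForm_skew hU hx hDbar β γ]
      ring
    rw [h, h1, h2, Finset.sum_add_distrib]
    simp only [indXi]
    ring
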